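/- All systems of equations are finite. A system $\bar w=(w_1,\dots,w_n)$ consists of finitely many elements of the free group on symbols for constants $\bar a=(a_1,\dots,a_r)$ and for variables $\bar x=(x_1,\dots,x_k)$. It is \emph{solvable in} a group $G$ if for all $\bar a\in G^r$ there is $\bar x\in G^k$ with $w_i(\bar a,\bar x)=1$ for $i=1,\dots,n$. It is \emph{solvable over} $G$ if there is a group $H$ containing $G$ as a subgroup such that for all $\bar a\in G^r$ there is $\bar x\in H^k$ with $w_i(\bar a,\bar x)=1$ for $i=1,\dots,n$. For a subset $X$ of a group $H$ and $n\in\mathbb N$ let $C_n(X,H)$ be the set of all products $\prod_{i=1}^n g_i^{-1}x_ig_i$ with $g_i\in H$ and $x_i\in X\cup X^{-1}$. Let $\mathcal K$ be a class of groups. A group $G$ is \emph{$\mathcal K$-approximable} if for every finite $\Phi\subseteq G$ and every $n\in\mathbb N$ there are a group $H\in\mathcal K$ and a map $\phi:\Phi\cup\{1\}\to H$ with $\phi(1)=1$ such that $\phi(\Phi\setminus\{1\})$ is disjoint from $C_n(X,H)$, where $X=\{\phi(g)\phi(h)\phi(gh)^{-1} : g,h,gh\in\Phi\}$. Let $\mathcal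 K.approx$ be the class of $\mathcal K$-approximable groups, and let $\prod(\mathcal K)$ be the class of all groups isomorphic to a direct product of a finite (possibly empty) family of groups from $\mathcal K$. Let $Nil$, $Sol$, $Fin$, $Alt$, $Sym$ be the classes of finite nilpotent groups, finite solvable groups, finite groups, alternating groups $A_m$ and symmetric groups $S_m$ ($m\ge 1$, up to isomorphism), respectively. A group $G$ is \emph{sofic} if there is a function $\alpha:G\to\mathbb R$ with $\alpha(1)=0$ and $\alpha(g)>0$ for $g\ne1$ such that for every finite $\Phi\subseteq G$ and every $\epsilon>0$ there are $m\ge1$ and a map $\phi:\Phi\cup\{1\}\to S_m$ with $\phi(1)=1$, with $\|\phi(g)\|\ge\alpha(g)$ for all $g\in\Phi$, and with $\|\phi(gh)(\phi(g)\phi(h))^{-1}\|<\epsilon$ whenever $g,h,gh\in\Phi$. Here $\|\sigma\|$ is the proportion of the points of $\{1,\dots,m\}$ that are moved by $\sigma$. \textbf{Corollary.} (1) Let $\mathcal K$ be a class of finite groups with $\mathcal K.approx=\prod(\mathcal K).approx$. Then a group $G$ is $\mathcal K$-approximable if and only if every system solvable in all groups of $\mathcal K$ is solvable over $G$. (2)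 Each of the classes $\mathcal K=Nil, Sol, Fin, Alt, Sym$ satisfies $\mathcal K.approx=\prod(\mathcal K).approx$. Hence, for each of them, a group $G$ is $\mathcal K$-approximable if and only if every system solvable in all groups of $\mathcal K$ is solvable over $G$. (3) A group $G$ is sofic if and only if every system solvable in all alternating groups is solvable over $G$. -/

import Mathlib

universe u

/-- A class of groups (the groups being those with carrier in `Type u`). -/
abbrev GroupClass : Type (u + 1) := ∀ (H : Type u) [Group H], Prop

/-- The set `C_n(X, G)` of `n`-consequences of `X` in `G`: all products
`x₁^{g₁} ⋯ xₙ^{gₙ}`, where each `xᵢ` or its inverse lies in `X`, each `gᵢ` lies in `G`, and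
`x^g = g⁻¹ x g`. -/
def consequences {G : Type*} [Group G] (n : ℕ) (X : Set G) : Set G :=
  {y | ∃ x g : Fin n → G, (∀ i, x i ∈ X ∨ (x i)⁻¹ ∈ X) ∧
    y = (List.ofFn fun i => (g i)⁻¹ * x i * g i).prod}

/-- `Y` is `n`-separated from `X`. -/
def IsSeparatedFrom {G : Type*} [Group G] (n : ℕ) (Y X : Set G) : Prop :=
  Y ∩ consequences n X = ∅

/-- The class of `K`-approximable groups. The map `φ` is only relevant on the finite set `Φ`
(and at `1`); it is written as a function on all of `G` for convenience. -/
def GroupClass.approx (K : GroupClass.{u}) : GroupClass.{u} := fun G _ =>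
  ∀ (Φ : Finset G) (n : ℕ), ∃ (H : Type u) (_ : Group H) (φ : G → H), K H ∧
    φ 1 = 1 ∧
    IsSeparatedFrom n (φ '' ((Φ : Set G) \ {1}))
      {z | ∃ g h : G, g ∈ Φ ∧ h ∈ Φ ∧ g * h ∈ Φ ∧ z = φ g * φ h * (φ (g * h))⁻¹}

/-- `∏(K)`: all groups isomorphic to a direct product of a finite (possibly empty) family of
groups from `K`. -/
def GroupClass.prod (K : GroupClass.{u}) : GroupClass.{u} := fun G _ =>
  ∃ (n : ℕ) (H : Fin n → Type u) (_ : ∀ i, Group (H i)),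
    (∀ i, K (H i)) ∧ Nonempty (G ≃* (∀ i, H i))

/-- The class of finite groups. -/
def GroupClass.fin : GroupClass.{u} := fun H _ => Finite H

/-- The class of finite nilpotent groups. -/
def GroupClass.nil : GroupClass.{u} := fun H _ => Finite H ∧ Group.IsNilpotent H

/-- The class of finite solvable groups. -/
def GroupClass.sol : GroupClass.{u} := fun H _ => Finite H ∧ Group.IsSolvable H

/-- The class of finite alternating groups `A_m`, `m ≥ 1` (up to isomorphism). -/
def GroupClass.alt : GroupClass.{u} := fun H _ =>
  ∃ m : ℕ, 0 < m ∧ Nonempty (H ≃* alternatingGroup (Fin m))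

/-- The class of finite symmetric groups `S_m`, `m ≥ 1` (up to isomorphism). -/
def GroupClass.sym : GroupClass.{u} := fun H _ =>
  ∃ m : ℕ, 0 < m ∧ Nonempty (H ≃* Equiv.Perm (Fin m))

/-- An invariant (pseudo) length function on a group. -/
structure InvariantLength (G : Type*) [Group G] where
  toFun : G → ℝ
  nonneg : ∀ g, 0 ≤ toFun g
  map_one : toFun 1 = 0
  mul_le : ∀ g h, toFun (g * h) ≤ toFun g + toFun h
  conj : ∀ g h, toFun (h⁻¹ * g * h) = toFun g

/-- Transport of an invariant length function along a homomorphism. -/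
def InvariantLength.comap {G H : Type*} [Group G] [Group H] (ℓ : InvariantLength H)
    (f : G →* H) : InvariantLength G where
  toFun g := ℓ.toFun (f g)
  nonneg g := ℓ.nonneg _
  map_one := by simp [ℓ.map_one]
  mul_le g h := by simpa using ℓ.mul_le (f g) (f h)
  conj g h := by simpa using ℓ.conj (f g) (f h)

/-- The class of `(K, L)`-approximable groups, where `L H` is the set of the chosen invariant
length functions on `H`. -/
def GroupClass.metricApprox (K : GroupClass.{u})
    (L : ∀ (H : Type u) [Group H], Set (InvariantLength H)) : GroupClass.{u} := fun G _ =>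
  ∃ α : G → ℝ, α 1 = 0 ∧ (∀ g, g ≠ 1 → 0 < α g) ∧
    ∀ (Φ : Finset G) (ε : ℝ), 0 < ε →
      ∃ (H : Type u) (_ : Group H) (φ : G → H) (ℓ : InvariantLength H), K H ∧ ℓ ∈ L H ∧
        φ 1 = 1 ∧ (∀ g ∈ Φ, α g ≤ ℓ.toFun (φ g)) ∧
        ∀ g ∈ Φ, ∀ h ∈ Φ, g * h ∈ Φ → ℓ.toFun (φ (g * h) * (φ g * φ h)⁻¹) < ε

/-- The normalized Hamming length on the symmetric group `S_m`: the proportion of points that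
are moved. -/
noncomputable def hammingLength (m : ℕ) : InvariantLength (Equiv.Perm (Fin m)) where
  toFun σ := (σ.support.card : ℝ) / m
  nonneg σ := by positivity
  map_one := by simp
  mul_le σ τ := by
    rw [← add_div]
    refine div_le_div_of_nonneg_right ?_ (Nat.cast_nonneg m)
    exact_mod_cast (Finset.card_le_card (Equiv.Perm.support_mul_le σ τ)).trans
      (Finset.card_union_le _ _)
  conj σ τ := by
    have h := Equiv.Perm.card_support_conj (σ := τ⁻¹) (τ := σ)
    rw [inv_inv] at h
    rw [h]

/-- The normalized Hamming length functions on the groups isomorphic to some `S_m`, `m ≥ 1`. -/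
def hammingLengths (H : Type u) [Group H] : Set (InvariantLength H) :=
  {ℓ | ∃ m : ℕ, 0 < m ∧ ∃ e : H ≃* Equiv.Perm (Fin m), ℓ = (hammingLength m).comap e.toMonoidHom}

/-- Sofic groups: metric approximability by symmetric groups with the Hamming lengths. -/
def IsSofic (G : Type u) [Group G] : Prop :=
  GroupClass.sym.{u}.metricApprox (fun H _ => hammingLengths H) G

/-- A finite system of equations `w₁ = 1, …, wₙ = 1`: finitely many elements of the free group
on the symbols for constants `a₁, …, a_r` (left summand) and for variables `x₁, …, x_k`
(right summand). -/
structure EquationSystem where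
  numConsts : ℕ
  numVars : ℕ
  numEqs : ℕ
  word : Fin numEqs → FreeGroup (Fin numConsts ⊕ Fin numVars)

/-- All equations of the system hold for the given values of constants and variables. -/
def EquationSystem.Holds (w : EquationSystem) {H : Type*} [Group H]
    (a : Fin w.numConsts → H) (x : Fin w.numVars → H) : Prop :=
  ∀ i, FreeGroup.lift (Sum.elim a x) (w.word i) = 1

/-- Solvability in `G`: for all values of the constants in `G` there is a solution in `G`. -/
def EquationSystem.SolvableIn (w : EquationSystem) (G : Type*) [Group G] : Prop :=
  ∀ a : Fin w.numConsts → G, ∃ x : Fin w.numVars → G, w.Holds a x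

/-- Solvability over `G`: there is one group `H` containing `G` such that for all values of the
constants in `G` there is a solution in `H`. -/
def EquationSystem.SolvableOver (w : EquationSystem) (G : Type u) [Group G] : Prop :=
  ∃ (H : Type u) (_ : Group H) (ι : G →* H), Function.Injective ι ∧
    ∀ a : Fin w.numConsts → G, ∃ x : Fin w.numVars → H, w.Holds (fun j => ι (a j)) x

/-- `Sys(K)`: the finite systems solvable in every group of `K`. -/
def GroupClass.sys (K : GroupClass.{u}) : Set EquationSystem :=
  {w | ∀ (H : Type u) [Group H], K H → w.SolvableIn H}

-- Part (1). Suppose `G` is approximable, and choose an approximation `φ i` for every pair `i` of a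
-- finite set and a bound. In the product of the target groups, the elements that are eventually
-- products of boundedly many conjugates of defects and their inverses form a normal subgroup.
-- Modulo it the `φ i` become a homomorphism, injective by separation, and solutions found
-- coordinatewise survive in the quotient. Conversely, if `G` is not `∏(K)`-approximable, some
-- equation "`g₀` is a product of `n` conjugates of prescribed defects" is solvable in all groups of
-- `K`. Over `G` the defects of the inclusion are trivial, so `g₀ = 1`, a contradiction.
--
-- Part (2). `Nil`, `Sol`, `Fin` are closed under finite products. For `Alt` and `Sym` the proof
-- passes through soficity. A sofic `G` is approximable because the Hamming length of an
-- `n`-consequence is at most `n` times the largest defect. The hard direction starts from a map `φ`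
-- into a finite product of alternating or symmetric groups. It rests on bounded generation
-- (`mem_evenPairs_pow`): an even permutation with support at most `C` times that of `σ` is a
-- product of `O(C)` pairs of conjugates of `σ` and `σ⁻¹`, uniformly in the degree. Hence
-- (`exists_consequence_bound`) an element of the normal closure of the defects which in every
-- coordinate is at most `C` times as long as some defect is a short consequence. By separation,
-- either `φ g` lies outside the normal closure, and the regular representation of the quotient
-- moves all points by `g`, or in some coordinate `φ g` is more than `C` times as long as every
-- defect, and a power of the action amplifies this. Product actions combine the different `g`. Part
-- (3) follows from the same circle of implications.

universe v

open scoped Pointwise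

/-! ### Consequences as powers of a conjugation-invariant set. -/

section Consequences

variable {G : Type*} [Group G]

/-- The conjugates of the elements of `X` and of their inverses. -/
def conjSet (X : Set G) : Set G :=
  {y | ∃ x g : G, (x ∈ X ∨ x⁻¹ ∈ X) ∧ y = g⁻¹ * x * g}

/-- With set powers, concatenating consequences is `pow_add`, and padding is monotonicity of powers
of a set containing `1`. -/
theorem consequences_eq_conjSet_pow (n : ℕ) (X : Set G) :
    consequences n X = conjSet X ^ n := by
  ext y
  rw [Set.mem_pow]
  constructor
  · rintro ⟨x, g, hx, rfl⟩
    exact ⟨fun i => ⟨(g i)⁻¹ * x i * g i, x i, g i, hx i, rfl⟩, rfl⟩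
  · rintro ⟨f, rfl⟩
    choose x g hx h using fun i => (f i).2
    exact ⟨x, g, hx, by simp only [h]⟩

theorem subset_conjSet (X : Set G) : X ⊆ conjSet X := fun x hx => ⟨x, 1, Or.inl hx, by simp⟩

theorem conjSet_inv (X : Set G) : (conjSet X)⁻¹ = conjSet X := by
  have key : ∀ y ∈ conjSet X, y⁻¹ ∈ conjSet X := by
    rintro _ ⟨x, g, hx, rfl⟩
    exact ⟨x⁻¹, g, by rw [inv_inv]; exact hx.symm, by group⟩
  ext y
  exact ⟨fun h => by simpa using key _ h, fun h => key _ h⟩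

theorem inv_mem_conjSet_pow {X : Set G} {n : ℕ} {y : G} (hy : y ∈ conjSet X ^ n) :
    y⁻¹ ∈ conjSet X ^ n := by
  rw [← Set.mem_inv, ← inv_pow, conjSet_inv]
  exact hy

theorem conj_mem_pow {S : Set G} {g : G} (hS : ∀ y ∈ S, g * y * g⁻¹ ∈ S) {n : ℕ} {y : G}
    (hy : y ∈ S ^ n) : g * y * g⁻¹ ∈ S ^ n := by
  have h1 : g * y * g⁻¹ ∈ (MulAut.conj g).toMonoidHom '' (S ^ n) := ⟨y, hy, rfl⟩
  rw [Set.image_pow] at h1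
  refine Set.pow_subset_pow_left ?_ h1
  rintro _ ⟨x, hx, rfl⟩
  exact hS x hx

theorem conj_mem_conjSet {X : Set G} (g y : G) (hy : y ∈ conjSet X) : g * y * g⁻¹ ∈ conjSet X := by
  obtain ⟨x, k, hx, rfl⟩ := hy
  exact ⟨x, k * g⁻¹, hx, by group⟩

theorem image_conjSet_subset {H : Type*} [Group H] (f : G →* H) (X : Set G) :
    f '' conjSet X ⊆ conjSet (f '' X) := by
  rintro _ ⟨_, ⟨x, g, hx, rfl⟩, rfl⟩
  refine ⟨f x, f g, ?_, by simp⟩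
  rcases hx with hx | hx
  · exact Or.inl ⟨x, hx, rfl⟩
  · exact Or.inr ⟨x⁻¹, hx, by simp⟩

/-- The defects of multiplicativity of `φ` on `Φ`. -/
def defects {H : Type*} [Group H] (Φ : Finset G) (φ : G → H) : Set H :=
  {z | ∃ g h : G, g ∈ Φ ∧ h ∈ Φ ∧ g * h ∈ Φ ∧ z = φ g * φ h * (φ (g * h))⁻¹}

/-- A trivial defect lets a short consequence count as a longer one. -/
theorem one_mem_defects {H : Type*} [Group H] {Φ : Finset G} {φ : G → H} (h1 : 1 ∈ Φ)
    (hφ : φ 1 = 1) : (1 : H) ∈ defects Φ φ :=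
  ⟨1, 1, h1, h1, by simpa using h1, by simp [hφ]⟩

theorem isSeparatedFrom_iff {H : Type*} [Group H] {Φ : Finset G} {φ : G → H} {n : ℕ} :
    IsSeparatedFrom n (φ '' ((Φ : Set G) \ {1}))
      {z | ∃ g h : G, g ∈ Φ ∧ h ∈ Φ ∧ g * h ∈ Φ ∧ z = φ g * φ h * (φ (g * h))⁻¹} ↔
    ∀ g ∈ Φ, g ≠ 1 → φ g ∉ conjSet (defects Φ φ) ^ n := by
  rw [IsSeparatedFrom, consequences_eq_conjSet_pow, ← Set.disjoint_iff_inter_eq_empty,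
    Set.disjoint_left, Set.forall_mem_image]
  exact ⟨fun h g hg h1 => h ⟨hg, h1⟩, fun h g hg => h g hg.1 hg.2⟩

end Consequences

theorem GroupClass.approx_iff (K : GroupClass.{u}) (G : Type u) [Group G] :
    K.approx G ↔ ∀ (Φ : Finset G) (n : ℕ), ∃ (H : Type u) (_ : Group H) (φ : G → H), K H ∧
      φ 1 = 1 ∧ ∀ g ∈ Φ, g ≠ 1 → φ g ∉ conjSet (defects Φ φ) ^ n := by
  simp only [GroupClass.approx, isSeparatedFrom_iff]

theorem GroupClass.approx_mono {K L : GroupClass.{u}} (h : ∀ (H : Type u) [Group H], K H → L H)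
    (G : Type u) [Group G] (hG : K.approx G) : L.approx G := by
  intro Φ n
  obtain ⟨H, _, φ, hK, hr⟩ := hG Φ n
  exact ⟨H, _, φ, h H hK, hr⟩

theorem GroupClass.le_prod (K : GroupClass.{u}) (H : Type u) [Group H] (hH : K H) : K.prod H :=
  ⟨1, fun _ => H, fun _ => inferInstance, fun _ => hH,
    ⟨(MulEquiv.funUnique (Fin 1) H).symm⟩⟩

theorem GroupClass.prod_mono {K L : GroupClass.{u}} (h : ∀ (H : Type u) [Group H], K H → L H)
    (G : Type u) [Group G] (hG : K.prod G) : L.prod G := by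
  obtain ⟨n, H, _, hK, e⟩ := hG
  exact ⟨n, H, _, fun i => h _ (hK i), e⟩

/-! ### From approximability to solvability over `G`. -/

section Holds

variable {H L : Type*} [Group H] [Group L]

theorem EquationSystem.Holds.map {w : EquationSystem} {a : Fin w.numConsts → H}
    {x : Fin w.numVars → H} (h : w.Holds a x) (f : H →* L) :
    w.Holds (fun i => f (a i)) (fun i => f (x i)) := by
  intro i
  have h2 : FreeGroup.lift (Sum.elim (fun i => f (a i)) (fun i => f (x i))) =
      f.comp (FreeGroup.lift (Sum.elim a x)) := by
    ext s
    rcases s with s | s <;> simp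
  rw [h2, MonoidHom.comp_apply, h i, map_one]

theorem EquationSystem.holds_pi {ι : Type*} {H : ι → Type*} [∀ i, Group (H i)]
    {w : EquationSystem} {a : Fin w.numConsts → ∀ i, H i} {x : Fin w.numVars → ∀ i, H i}
    (h : ∀ i, w.Holds (fun j => a j i) (fun j => x j i)) : w.Holds a x := by
  intro k
  funext i
  have h2 : FreeGroup.lift (Sum.elim (fun j => a j i) (fun j => x j i)) =
      (Pi.evalMonoidHom H i).comp (FreeGroup.lift (Sum.elim a x)) := by
    ext s
    rcases s with s | s <;> simp
  have h3 := h i k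
  rw [h2] at h3
  exact h3

end Holds

/-- The normal subgroup of those elements of `∏ i, H i` that eventually are products of boundedly
many conjugates of elements of `X i` and their inverses. -/
def boundedConsequences {I : Type*} (l : Filter I) {H : I → Type*} [∀ i, Group (H i)]
    (X : ∀ i, Set (H i)) : Subgroup (∀ i, H i) where
  carrier := {h | ∃ m, ∀ᶠ i in l, h i ∈ conjSet (X i) ^ m}
  one_mem' := ⟨0, by simp⟩
  mul_mem' := by
    rintro a b ⟨m, hm⟩ ⟨k, hk⟩
    refine ⟨m + k, ?_⟩
    filter_upwards [hm, hk] with i h1 h2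
    rw [pow_add]
    exact Set.mul_mem_mul h1 h2
  inv_mem' := by
    rintro a ⟨m, hm⟩
    refine ⟨m, ?_⟩
    filter_upwards [hm] with i h1
    exact inv_mem_conjSet_pow h1

instance {I : Type*} (l : Filter I) {H : I → Type*} [∀ i, Group (H i)]
    (X : ∀ i, Set (H i)) : (boundedConsequences l X).Normal where
  conj_mem := by
    rintro a ⟨m, hm⟩ g
    refine ⟨m, ?_⟩
    filter_upwards [hm] with i h1
    exact conj_mem_pow (conj_mem_conjSet (g i)) h1

open Filter in
theorem GroupClass.approx.solvableOver {K : GroupClass.{u}} {G : Type u} [Group G]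
    (hG : K.approx G) {w : EquationSystem} (hw : w ∈ K.sys) : w.SolvableOver G := by
  classical
  rw [GroupClass.approx_iff] at hG
  choose H inst φ hK hφ1 hφ using fun i : Finset G × ℕ => hG i.1 i.2
  let N := boundedConsequences (atTop : Filter (Finset G × ℕ)) (fun i => defects i.1 (φ i))
  have hlarge : ∀ g : G, ∀ᶠ i : Finset G × ℕ in atTop, g ∈ i.1 := fun g => by
    filter_upwards [eventually_ge_atTop (({g}, 0) : Finset G × ℕ)] with i hi
    exact hi.1 (Finset.mem_singleton_self g)
  let ι : G →* (∀ i, H i) ⧸ N := MonoidHom.mk' (fun g => QuotientGroup.mk fun i => φ i g) (by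
    intro g h
    rw [← QuotientGroup.mk_mul, eq_comm, QuotientGroup.eq_iff_div_mem]
    refine ⟨1, ?_⟩
    filter_upwards [hlarge g, hlarge h, hlarge (g * h)] with i h1 h2 h3
    rw [pow_one]
    exact subset_conjSet _ ⟨g, h, h1, h2, h3, by simp [div_eq_mul_inv]⟩)
  refine ⟨(∀ i, H i) ⧸ N, inferInstance, ι, ?_, ?_⟩
  · rw [injective_iff_map_eq_one]
    intro g hg
    by_contra hne
    obtain ⟨m, hm⟩ := (QuotientGroup.eq_one_iff _).1 hg
    -- The index has bound at least `m` and its finite set contains `g` and `1`. As `1` is then a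
    -- defect, the `m`-consequence `φ i g` is also an `i.2`-consequence, contradicting separation.
    obtain ⟨i, hi1, hi2, hi3, hi4⟩ := (hm.and ((hlarge g).and ((hlarge 1).and
      (eventually_ge_atTop ((∅, m) : Finset G × ℕ))))).exists
    exact hφ i g hi2 hne (Set.pow_subset_pow_right
      (subset_conjSet _ (one_mem_defects hi3 (hφ1 i))) hi4.2 hi1)
  · intro a
    choose x hx using fun i => hw (H i) (hK i) (fun j => φ i (a j))
    exact ⟨fun j => QuotientGroup.mk fun i => x i j,
      (EquationSystem.holds_pi (a := fun j i => φ i (a j)) (x := fun j i => x i j) hx).map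
        (QuotientGroup.mk' N)⟩

/-! ### From solvability over `G` to approximability by products. -/

section Selection

variable {G : Type u} [Group G]

/-- Signed pairs of elements of `Φ` with product in `Φ`: the labels of the defects and of their
inverses. -/
abbrev DefectLabel (Φ : Finset G) : Type u :=
  {p : Φ × Φ // (p.1 * p.2 : G) ∈ Φ} × Bool

/-- The signed defect with a given label. -/
def DefectLabel.eval {Φ : Finset G} (t : DefectLabel Φ) {H : Type*} [Group H] (φ : G → H) : H :=
  let z := φ t.1.1.1 * φ t.1.1.2 * (φ (t.1.1.1 * t.1.1.2))⁻¹
  if t.2 then z else z⁻¹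

theorem DefectLabel.exists_eval {Φ : Finset G} {H : Type*} [Group H] {φ : G → H} {y : H}
    (hy : y ∈ conjSet (defects Φ φ)) :
    ∃ (t : DefectLabel Φ) (g : H), y = g⁻¹ * t.eval φ * g := by
  obtain ⟨x, k, hx, rfl⟩ := hy
  rcases hx with ⟨g, h, hg, hh, hgh, h1⟩ | ⟨g, h, hg, hh, hgh, h1⟩
  · exact ⟨(⟨(⟨g, hg⟩, ⟨h, hh⟩), hgh⟩, true), k, by simp [DefectLabel.eval, h1]⟩
  · refine ⟨(⟨(⟨g, hg⟩, ⟨h, hh⟩), hgh⟩, false), k, ?_⟩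
    rw [inv_eq_iff_eq_inv] at h1
    simp [DefectLabel.eval, h1]

theorem DefectLabel.map_eval {Φ : Finset G} (t : DefectLabel Φ) {H L : Type*} [Group H] [Group L]
    (φ : G → H) (f : H →* L) : f (t.eval φ) = t.eval (fun g => f (φ g)) := by
  unfold DefectLabel.eval
  by_cases h : t.2 <;> simp [h]

/-- The equation `φ g₀ = ∏ yᵢ⁻¹ sᵢ yᵢ`. -/
def SelectionHolds {Φ : Finset G} {n : ℕ} (g₀ : G) (s : Fin n → DefectLabel Φ)
    {H : Type*} [Group H] (φ : G → H) (y : Fin n → H) : Prop :=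
  φ g₀ = (List.ofFn fun i => (y i)⁻¹ * (s i).eval φ * y i).prod

theorem SelectionHolds.map {Φ : Finset G} {n : ℕ} {g₀ : G} {s : Fin n → DefectLabel Φ}
    {H L : Type*} [Group H] [Group L] {φ : G → H} {y : Fin n → H}
    (h : SelectionHolds g₀ s φ y) (f : H →* L) :
    SelectionHolds g₀ s (fun g => f (φ g)) (fun i => f (y i)) := by
  unfold SelectionHolds at h ⊢
  simp only [h, map_list_prod, List.map_ofFn, Function.comp_def, map_mul, map_inv,
    DefectLabel.map_eval]

/-- There are only finitely many pairs of an element `g` and a pattern `s` of labels. If each pair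
is refuted by some map into a group of `K`, the product of these maps refutes all of them at once
and is an approximation. This is where `∏(K)` enters. -/
theorem GroupClass.exists_selection {K : GroupClass.{u}} (hG : ¬ K.prod.approx G) :
    ∃ (Φ : Finset G) (n : ℕ) (g₀ : G) (s : Fin n → DefectLabel Φ), g₀ ∈ Φ ∧ g₀ ≠ 1 ∧
      ∀ (H : Type u) [Group H], K H → ∀ φ : G → H, φ 1 = 1 → ∃ y, SelectionHolds g₀ s φ y := by
  classical
  contrapose! hG
  rw [GroupClass.approx_iff]
  intro Φ n
  let T := {g : Φ // (g : G) ≠ 1} × (Fin n → DefectLabel Φ)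
  obtain ⟨N, ⟨e⟩⟩ := Finite.exists_equiv_fin T
  choose H inst hK φ hφ1 hφ using fun k : Fin N =>
    hG Φ n ((e.symm k).1 : G) (e.symm k).2 (e.symm k).1.1.2 (e.symm k).1.2
  refine ⟨∀ k, H k, inferInstance, fun g k => φ k g, ⟨N, H, inst, hK, ⟨MulEquiv.refl _⟩⟩,
    funext hφ1, fun g hg hg1 hmem => ?_⟩
  obtain ⟨f, hf⟩ := Set.mem_pow.1 hmem
  choose s y hy using fun i => DefectLabel.exists_eval (f i).2
  have hsel : SelectionHolds g s (fun g k => φ k g) y := by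
    refine hf.symm.trans ?_
    simp only [hy]
  let k := e (⟨⟨g, hg⟩, hg1⟩, s)
  have h2 := hφ k (fun i => y i k)
  rw [show e.symm k = (⟨⟨g, hg⟩, hg1⟩, s) from e.symm_apply_apply _] at h2
  exact h2 (hsel.map (Pi.evalMonoidHom H k))

theorem GroupClass.prod_approx_of_solvableOver {K : GroupClass.{u}}
    (hG : ∀ w ∈ K.sys, w.SolvableOver G) : K.prod.approx G := by
  classical
  by_contra hcon
  obtain ⟨Φ, n, g₀, s, hg₀, hne, h⟩ := GroupClass.exists_selection hcon
  let e := Fintype.equivFin Φ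
  let F := FreeGroup (Fin (Fintype.card Φ) ⊕ Fin n)
  -- The identity gets the empty word instead of a constant, because the selected equation is known
  -- to be solvable only for maps with `φ 1 = 1`. Elements outside `Φ` do not occur in it.
  let c : G → F := fun g =>
    if hg : g ∈ Φ ∧ g ≠ 1 then FreeGroup.of (Sum.inl (e ⟨g, hg.1⟩)) else 1
  let w : EquationSystem := ⟨Fintype.card Φ, n, 1, fun _ =>
    (c g₀)⁻¹ * (List.ofFn fun i => (FreeGroup.of (Sum.inr i))⁻¹ * (s i).eval c *
      FreeGroup.of (Sum.inr i)).prod⟩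
  have key : ∀ {H : Type u} [Group H] (a : Fin w.numConsts → H) (x : Fin w.numVars → H),
      w.Holds a x ↔ SelectionHolds g₀ s
        (fun g => if hg : g ∈ Φ ∧ g ≠ 1 then a (e ⟨g, hg.1⟩) else 1) x := by
    intro H _ a x
    have hc : ∀ g, FreeGroup.lift (Sum.elim a x) (c g) =
        (if hg : g ∈ Φ ∧ g ≠ 1 then a (e ⟨g, hg.1⟩) else 1) := by
      intro g
      by_cases hg : g ∈ Φ ∧ g ≠ 1 <;> simp [c, hg]
    constructor
    · intro hw
      have h0 := hw 0
      simp only [w, map_mul, map_inv, map_list_prod, List.map_ofFn, Function.comp_def,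
        DefectLabel.map_eval, hc, FreeGroup.lift_apply_of, Sum.elim_inr] at h0
      exact (inv_mul_eq_one.1 h0)
    · intro hw i
      simp only [w, map_mul, map_inv, map_list_prod, List.map_ofFn, Function.comp_def,
        DefectLabel.map_eval, hc, FreeGroup.lift_apply_of, Sum.elim_inr]
      exact inv_mul_eq_one.2 hw
  have hw : w ∈ K.sys := by
    intro H _ hK a
    obtain ⟨y, hy⟩ := h H hK (fun g => if hg : g ∈ Φ ∧ g ≠ 1 then a (e ⟨g, hg.1⟩) else 1)
      (by simp)
    exact ⟨y, (key a y).2 hy⟩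
  obtain ⟨H, _, ι, hι, hsol⟩ := hG w hw
  -- Each constant is given the element of `Φ` that it stands for. All defects then vanish, since
  -- `ι` is a homomorphism.
  obtain ⟨x, hx⟩ := hsol fun j => (e.symm j : G)
  have hx := (key _ _).1 hx
  have hval : ∀ g ∈ Φ, (if hg : g ∈ Φ ∧ g ≠ 1 then ι (e.symm (e ⟨g, hg.1⟩) : G) else 1) = ι g := by
    intro g hg
    by_cases h1 : g = 1 <;> simp [h1, hg]
  unfold SelectionHolds at hx
  have hs : ∀ i, (s i).eval
      (fun g => if hg : g ∈ Φ ∧ g ≠ 1 then ι (e.symm (e ⟨g, hg.1⟩) : G) else 1) = 1 := by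
    intro i
    simp only [DefectLabel.eval]
    rw [hval _ (s i).1.1.1.2, hval _ (s i).1.1.2.2, hval _ (s i).1.2]
    simp
  simp only [hs] at hx
  rw [hval g₀ hg₀] at hx
  apply hne
  apply hι
  rw [hx, map_one]
  simp

end Selection

/-! ### The criterion, and the classes closed under finite products. -/

theorem GroupClass.approx_iff_solvableOver {K : GroupClass.{u}} (hK : K.approx = K.prod.approx)
    (G : Type u) [Group G] : K.approx G ↔ ∀ w ∈ K.sys, w.SolvableOver G := by
  refine ⟨fun hG w hw => hG.solvableOver hw, fun h => ?_⟩
  rw [hK]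
  exact GroupClass.prod_approx_of_solvableOver h

theorem GroupClass.approx_eq_prod_approx_of_imp {K : GroupClass.{u}}
    (h : ∀ (G : Type u) [Group G], K.prod.approx G → K.approx G) : K.approx = K.prod.approx := by
  funext G inst
  exact propext ⟨GroupClass.approx_mono K.le_prod G, h G⟩

theorem GroupClass.fin_approx : GroupClass.fin.{u}.approx = GroupClass.fin.{u}.prod.approx := by
  refine GroupClass.approx_eq_prod_approx_of_imp fun G _ => GroupClass.approx_mono ?_ G
  rintro H _ ⟨n, L, _, hL, ⟨e⟩⟩
  have : ∀ i, Finite (L i) := hL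
  exact Finite.of_equiv _ e.symm.toEquiv

theorem GroupClass.nil_approx : GroupClass.nil.{u}.approx = GroupClass.nil.{u}.prod.approx := by
  refine GroupClass.approx_eq_prod_approx_of_imp fun G _ => GroupClass.approx_mono ?_ G
  rintro H _ ⟨n, L, _, hL, ⟨e⟩⟩
  have h1 : ∀ i, Finite (L i) := fun i => (hL i).1
  have h2 : ∀ i, Group.IsNilpotent (L i) := fun i => (hL i).2
  exact ⟨Finite.of_equiv _ e.symm.toEquiv, Group.nilpotent_of_mulEquiv e.symm⟩

theorem isSolvable_pi_fin : ∀ {n : ℕ} (L : Fin n → Type u) [∀ i, Group (L i)]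
    [∀ i, Group.IsSolvable (L i)], Group.IsSolvable (∀ i, L i)
  | 0, L, _, _ => inferInstance
  | n + 1, L, _, _ => by
    have := isSolvable_pi_fin fun i : Fin n => L i.succ
    let f : (∀ i, L i) →* L 0 × ∀ i : Fin n, L i.succ :=
      (Pi.evalMonoidHom L 0).prod (MonoidHom.pi fun i => Pi.evalMonoidHom L i.succ)
    refine Group.isSolvable_of_isSolvable_injective (f := f) fun a b hab => ?_
    funext i
    refine Fin.cases ?_ (fun j => ?_) i
    · exact congrArg Prod.fst hab
    · exact congrFun (congrArg Prod.snd hab) j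

theorem GroupClass.sol_approx : GroupClass.sol.{u}.approx = GroupClass.sol.{u}.prod.approx := by
  refine GroupClass.approx_eq_prod_approx_of_imp fun G _ => GroupClass.approx_mono ?_ G
  rintro H _ ⟨n, L, _, hL, ⟨e⟩⟩
  have h1 : ∀ i, Finite (L i) := fun i => (hL i).1
  have h2 : ∀ i, Group.IsSolvable (L i) := fun i => (hL i).2
  have := isSolvable_pi_fin L
  exact ⟨Finite.of_equiv _ e.symm.toEquiv,
    Group.isSolvable_of_isSolvable_injective (f := e.toMonoidHom) e.injective⟩

/-! ### Involutions in symmetric groups. -/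

section Involutions

open Equiv Equiv.Perm

/-- Every permutation is a product of two involutions: reverse every orbit. -/
theorem exists_eq_mul_involutions {α : Type*} (τ : Perm α) :
    ∃ u v : Perm α, u * u = 1 ∧ v * v = 1 ∧ τ = u * v ∧ (∀ x, τ x = x → u x = x) ∧
      ∀ x, τ x = x → v x = x := by
  let b : α → α := fun x => (Quotient.mk (SameCycle.setoid τ) x).out
  have hb : ∀ x, SameCycle τ (b x) x := fun x => Quotient.mk_out (s := SameCycle.setoid τ) x
  have hbeq : ∀ x y, SameCycle τ x y → b x = b y := fun x y h =>
    congrArg Quotient.out (Quotient.sound (s := SameCycle.setoid τ) h)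
  choose i hi using hb
  -- Reflection of each orbit in its base point `b x`. On a finite cycle the exponent `i x` is not
  -- unique; `hu` shows that it does not matter.
  let u : α → α := fun x => (τ ^ (-i x)) (b x)
  have hu : ∀ x (j : ℤ), (τ ^ j) (b x) = x → u x = (τ ^ (-j)) (b x) := by
    intro x j hj
    have h1 : (τ ^ (-j)) ((τ ^ (-i x)) ((τ ^ i x) (b x))) =
        (τ ^ (-j)) ((τ ^ (-i x)) ((τ ^ j) (b x))) := by rw [hj, hi]
    simp only [← mul_apply, ← zpow_add] at h1
    rw [show -j + (-i x + i x) = -j by ring, show -j + (-i x + j) = -i x by ring] at h1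
    exact h1.symm
  have hbu : ∀ x, b (u x) = b x := fun x => by
    rw [show b x = b (b x) from (hbeq _ _ ⟨i x, hi x⟩).symm]
    exact (hbeq _ _ ⟨-i x, rfl⟩).symm
  have huu : ∀ x, u (u x) = x := fun x => by
    rw [hu (u x) (-i x) (by rw [hbu]), neg_neg, hbu, hi]
  have hτu : ∀ x, τ (u (τ x)) = u x := fun x => by
    have hbτ : b (τ x) = b x := (hbeq _ _ ⟨1, by simp⟩).symm
    have h1 := hu (τ x) (1 + i x) (by rw [hbτ, zpow_add, mul_apply, hi, zpow_one])
    rw [h1, hbτ, ← mul_apply, ← zpow_one_add, show 1 + -(1 + i x) = -i x by ring]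
  let U : Perm α := Function.Involutive.toPerm u huu
  have hUU : U * U = 1 := Equiv.ext huu
  have hfix : ∀ x, τ x = x → U x = x := fun x hx => by
    have hz : ∀ k : ℤ, (τ ^ k) x = x := fun k => zpow_apply_eq_self_of_apply_eq_self hx k
    have hbx : b x = x := by
      obtain ⟨k, hk⟩ := (SameCycle.symm ⟨i x, hi x⟩ : SameCycle τ x (b x))
      rw [← hk, hz]
    change (τ ^ (-i x)) (b x) = x
    rw [hbx, hz]
  refine ⟨U, U * τ, hUU, ?_, ?_, hfix, fun x hx => ?_⟩
  · have h1 : τ * (U * τ) = U := Equiv.ext hτu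
    rw [mul_assoc, h1, hUU]
  · rw [← mul_assoc, hUU, one_mul]
  · rw [mul_apply, hx, hfix x hx]

variable {α : Type*} [Fintype α] [DecidableEq α]

theorem cycleType_of_sq_eq_one {u : Perm α} (hu : u * u = 1) :
    u.cycleType = Multiset.replicate u.cycleType.card 2 ∧
      u.support.card = 2 * u.cycleType.card := by
  have : Fact (Nat.Prime 2) := ⟨Nat.prime_two⟩
  have h1 : ∀ c ∈ u.cycleType, c = 2 := pow_prime_eq_one_iff.1 (by rw [pow_two, hu])
  have h2 := Multiset.eq_replicate_card.2 h1
  refine ⟨h2, ?_⟩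
  rw [← sum_cycleType]
  conv_lhs => rw [h2]
  simp [mul_comm]

theorem sign_of_sq_eq_one {u : Perm α} (hu : u * u = 1) {k : ℕ} (hk : u.support.card = 2 * k) :
    sign u = (-1) ^ k := by
  obtain ⟨h1, h2⟩ := cycleType_of_sq_eq_one hu
  have h3 : u.cycleType.card = k := by omega
  rw [sign_of_cycleType, sum_cycleType, hk, h3, pow_add, pow_mul]
  simp

/-- Equal supports give equal cycle types. An odd conjugator is corrected by the transposition `swap
a (u a)`, a cycle of `u` and so commuting with `u`. -/
theorem exists_even_conj_of_sq_eq_one {u v : Perm α} (hu : u * u = 1) (hv : v * v = 1)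
    (h : u.support.card = v.support.card) : ∃ y ∈ alternatingGroup α, y * u * y⁻¹ = v := by
  by_cases h1 : u = 1
  · refine ⟨1, one_mem _, ?_⟩
    rw [h1, support_one, Finset.card_empty, eq_comm, card_support_eq_zero] at h
    simp [h1, h]
  have hconj : IsConj u v := by
    rw [isConj_iff_cycleType_eq, (cycleType_of_sq_eq_one hu).1, (cycleType_of_sq_eq_one hv).1]
    congr 1
    have := (cycleType_of_sq_eq_one hu).2
    have := (cycleType_of_sq_eq_one hv).2
    omega
  obtain ⟨y, hy⟩ := isConj_iff.1 hconj
  rcases Int.units_eq_one_or (sign y) with hs | hs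
  · exact ⟨y, mem_alternatingGroup.2 hs, hy⟩
  obtain ⟨a, ha⟩ : ∃ a, u a ≠ a := by
    by_contra! hcon
    exact h1 (Equiv.ext hcon)
  refine ⟨y * swap a (u a), ?_, ?_⟩
  · rw [mem_alternatingGroup, map_mul, hs, sign_swap ha.symm]
    simp
  · have hc : u * swap a (u a) = swap a (u a) * u := by
      rw [mul_swap_eq_swap_mul]
      have : u (u a) = a := by rw [← mul_apply, hu, one_apply]
      rw [this, swap_comm]
    rw [← hy, mul_inv_rev, swap_inv]
    calc y * swap a (u a) * u * (swap a (u a) * y⁻¹)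
        = y * (swap a (u a) * u * swap a (u a)) * y⁻¹ := by group
      _ = y * u * y⁻¹ := by rw [← hc, mul_assoc u, swap_mul_self, mul_one]

/-- Disjoint copies of `Perm (Fin n)` acting on a given finite set. -/
theorem exists_blocks (n e : ℕ) (B : Finset α) (h : n * e ≤ B.card) :
    ∃ Ψ : (Fin e → Perm (Fin n)) →* Perm α, ∀ p, (Ψ p).support ⊆ B ∧
      (Ψ p).support.card = ∑ i, (p i).support.card := by
  have hc : Fintype.card (Σ _ : Fin e, Fin n) ≤ Fintype.card B := by
    simpa [mul_comm] using h
  obtain ⟨f⟩ := Function.Embedding.nonempty_of_card_le hc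
  let f' : (Σ _ : Fin e, Fin n) ↪ α := f.trans (Function.Embedding.subtype _)
  refine ⟨(viaEmbeddingHom f').comp (sigmaCongrRightHom fun _ => Fin n), fun p => ?_⟩
  have hs : (viaEmbedding (Perm.sigmaCongrRight p) f').support =
      (Finset.univ.sigma fun i => (p i).support).map f' := by
    ext x
    rw [mem_support]
    by_cases hx : x ∈ Set.range f'
    · obtain ⟨⟨i, j⟩, rfl⟩ := hx
      rw [viaEmbedding_apply, f'.injective.ne_iff, Finset.mem_map' f']
      simp
    · rw [viaEmbedding_apply_of_notMem _ _ _ hx]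
      simp only [ne_eq, not_true_eq_false, Finset.mem_map, false_iff]
      rintro ⟨y, -, hy⟩
      exact hx ⟨y, hy⟩
  change (viaEmbedding (Perm.sigmaCongrRight p) f').support ⊆ B ∧
    (viaEmbedding (Perm.sigmaCongrRight p) f').support.card = _
  rw [hs, Finset.card_map, Finset.card_sigma]
  refine ⟨fun x hx => ?_, rfl⟩
  obtain ⟨y, -, rfl⟩ := Finset.mem_map.1 hx
  exact (f y).2

theorem sum_ite_val_lt (e l a b : ℕ) (h : l ≤ e) :
    ∑ i : Fin e, (if i.val < l then a else b) = a * l + b * (e - l) := by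
  rw [Fin.sum_univ_eq_sum_range (fun i => if i < l then a else b), Finset.sum_ite]
  have h1 : (Finset.range e).filter (· < l) = Finset.range l := by
    ext; simp; omega
  have h2 : ((Finset.range e).filter (fun i => ¬ i < l)) = Finset.Ico l e := by
    ext; simp; omega
  rw [h1, h2]
  simp [mul_comm]

/-- An involution is a product of two longer involutions of equal length. -/
theorem exists_eq_mul_of_le {w : Perm α} (hw : w * w = 1) {e l : ℕ} (hl : w.support.card = 4 * l)
    (hle : l ≤ e) (he : 4 * e ≤ Fintype.card α) :
    ∃ r s : Perm α, r * r = 1 ∧ s * s = 1 ∧ r.support.card = 4 * e ∧ s.support.card = 4 * e ∧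
      w = r * s := by
  obtain ⟨Ψ, hΨ⟩ := exists_blocks (α := α) 4 e Finset.univ (by simpa using he)
  -- `x`, `y` and `x * y` are the involutions of the Klein four-group. So `p * q` is a double
  -- transposition on the first `l` blocks and trivial on the others, while `p` and `q` move every
  -- block.
  let x : Perm (Fin 4) := swap 0 1 * swap 2 3
  let y : Perm (Fin 4) := swap 0 2 * swap 1 3
  let p : Fin e → Perm (Fin 4) := fun _ => x
  let q : Fin e → Perm (Fin 4) := fun i => if i.val < l then y else x
  have hx : x * x = 1 := by decide
  have hy : y * y = 1 := by decide
  have hxy : x * y * (x * y) = 1 := by decide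
  have hxc : x.support.card = 4 := by decide
  have hyc : y.support.card = 4 := by decide
  have hxyc : (x * y).support.card = 4 := by decide
  have hpp : p * p = 1 := funext fun i => hx
  have hqq : q * q = 1 := funext fun i => by
    by_cases h : i.val < l <;> simp [q, h, hx, hy]
  have hpq : p * q * (p * q) = 1 := funext fun i => by
    by_cases h : i.val < l <;> simp [p, q, h, hx, hxy]
  have hpc : (Ψ p).support.card = 4 * e := by
    rw [(hΨ p).2]
    simp [p, hxc, mul_comm]
  have hqc : (Ψ q).support.card = 4 * e := by
    rw [(hΨ q).2, Finset.sum_congr rfl (g := fun _ => 4)]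
    · simp [mul_comm]
    · intro i _
      by_cases h : i.val < l <;> simp [q, h, hxc, hyc]
  have hpqc : (Ψ (p * q)).support.card = 4 * l := by
    rw [(hΨ _).2, Finset.sum_congr rfl (g := fun i : Fin e => if i.val < l then 4 else 0),
      sum_ite_val_lt _ _ _ _ hle]
    · simp
    · intro i _
      by_cases h : i.val < l <;> simp [p, q, h, hx, hxyc]
  obtain ⟨g, -, hg⟩ := exists_even_conj_of_sq_eq_one (u := Ψ (p * q)) (v := w)
    (by rw [← map_mul, hpq, map_one]) hw (by rw [hpqc, hl])
  refine ⟨g * Ψ p * g⁻¹, g * Ψ q * g⁻¹, ?_, ?_, ?_, ?_, ?_⟩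
  · rw [conj_mul, ← map_mul, hpp]; simp
  · rw [conj_mul, ← map_mul, hqq]; simp
  · rw [card_support_conj, hpc]
  · rw [card_support_conj, hqc]
  · rw [conj_mul, ← map_mul, hg]

/-- An involution can be split into two shorter ones. -/
theorem exists_eq_mul_of_add {w : Perm α} (hw : w * w = 1) {k l : ℕ}
    (hl : w.support.card = 2 * (k + l)) :
    ∃ r s : Perm α, r * r = 1 ∧ s * s = 1 ∧ r.support.card = 2 * k ∧ s.support.card = 2 * l ∧
      w = r * s := by
  obtain ⟨Ψ, hΨ⟩ := exists_blocks (α := α) 2 (k + l) Finset.univ (by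
    rw [← hl]; exact Finset.card_le_univ _)
  let x : Perm (Fin 2) := swap 0 1
  let p : Fin (k + l) → Perm (Fin 2) := fun i => if i.val < k then x else 1
  let q : Fin (k + l) → Perm (Fin 2) := fun i => if i.val < k then 1 else x
  have hx : x * x = 1 := by decide
  have hxc : x.support.card = 2 := by decide
  have hpp : p * p = 1 := funext fun i => by
    by_cases h : i.val < k <;> simp [p, h, hx]
  have hqq : q * q = 1 := funext fun i => by
    by_cases h : i.val < k <;> simp [q, h, hx]
  have hpq : p * q = fun _ => x := funext fun i => by
    by_cases h : i.val < k <;> simp [p, q, h]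
  have hpc : (Ψ p).support.card = 2 * k := by
    rw [(hΨ _).2, Finset.sum_congr rfl (g := fun i : Fin (k + l) => if i.val < k then 2 else 0),
      sum_ite_val_lt _ _ _ _ (by omega)]
    · simp
    · intro i _
      by_cases h : i.val < k <;> simp [p, h, hxc]
  have hqc : (Ψ q).support.card = 2 * l := by
    rw [(hΨ _).2, Finset.sum_congr rfl (g := fun i : Fin (k + l) => if i.val < k then 0 else 2),
      sum_ite_val_lt _ _ _ _ (by omega)]
    · simp
    · intro i _
      by_cases h : i.val < k <;> simp [q, h, hxc]
  have hpqc : (Ψ (p * q)).support.card = 2 * (k + l) := by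
    rw [(hΨ _).2, hpq]
    simp [hxc, mul_comm]
  obtain ⟨g, -, hg⟩ := exists_even_conj_of_sq_eq_one (u := Ψ (p * q)) (v := w)
    (by rw [← map_mul, hpq, ← map_one Ψ]; congr 1; exact funext fun i => hx) hw (by rw [hpqc, hl])
  refine ⟨g * Ψ p * g⁻¹, g * Ψ q * g⁻¹, ?_, ?_, ?_, ?_, ?_⟩
  · rw [conj_mul, ← map_mul, hpp]; simp
  · rw [conj_mul, ← map_mul, hqq]; simp
  · rw [card_support_conj, hpc]
  · rw [card_support_conj, hqc]
  · rw [conj_mul, ← map_mul, hg]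

end Involutions

/-! ### Bounded generation of alternating groups. -/

section Generation

open Equiv Equiv.Perm

variable {α : Type*} [Fintype α] [DecidableEq α]

/-- An involution with `l ≤ e` is a product of two conjugates of `r`, which costs `2 + 2` factors. A
longer one is shortened by splitting off an involution with support `4 * e`, at the same cost. -/
theorem involution_mem_pow {S : Set (Perm α)} (h1 : 1 ∈ S)
    (hS : ∀ g ∈ alternatingGroup α, ∀ y ∈ S, g * y * g⁻¹ ∈ S) {e : ℕ} {r : Perm α}
    (hr : r * r = 1) (hre : r.support.card = 4 * e) (hrS : r ∈ S ^ 2) (c : ℕ) :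
    ∀ (l : ℕ) (w : Perm α), w * w = 1 → w.support.card = 4 * l → l ≤ c * e → w ∈ S ^ (4 * c) := by
  have hcard : 4 * e ≤ Fintype.card α := hre ▸ Finset.card_le_univ _
  have hall : ∀ s : Perm α, s * s = 1 → s.support.card = 4 * e → s ∈ S ^ 2 := by
    intro s hs hse
    obtain ⟨g, hg, rfl⟩ := exists_even_conj_of_sq_eq_one hr hs (hre.trans hse.symm)
    exact conj_mem_pow (hS g hg) hrS
  have hsmall : ∀ (l : ℕ) (w : Perm α), w * w = 1 → w.support.card = 4 * l → l ≤ e →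
      w ∈ S ^ 4 := by
    intro l w hw hl hle
    obtain ⟨a, b, ha, hb, hae, hbe, rfl⟩ := exists_eq_mul_of_le hw hl hle hcard
    rw [show 4 = 2 + 2 from rfl, pow_add]
    exact Set.mul_mem_mul (hall a ha hae) (hall b hb hbe)
  induction c with
  | zero =>
    intro l w hw hl hle
    have h0 : w.support.card = 0 := by
      rw [hl]; simpa using hle
    rw [card_support_eq_zero] at h0
    simp [h0]
  | succ c ih =>
    intro l w hw hl hle
    by_cases hlt : l ≤ e
    · exact Set.pow_subset_pow_right h1 (by omega) (hsmall l w hw hl hlt)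
    · obtain ⟨a, b, ha, hb, hae, hbe, rfl⟩ := exists_eq_mul_of_add (k := 2 * e)
        (l := 2 * (l - e)) hw
        (by omega)
      rw [show 4 * (c + 1) = 4 + 4 * c by ring, pow_add]
      refine Set.mul_mem_mul (hsmall e a ha (by omega) le_rfl)
        (ih (l - e) b hb (by omega) ?_)
      rw [add_one_mul] at hle
      omega

/-- Write `τ = u * v` with involutions. Evenness of `τ` makes their numbers of transpositions
congruent modulo 2. If both are even, `involution_mem_pow` applies to each factor; if both are odd,
one transposition is taken from each and the two are completed to double transpositions. -/
theorem even_mem_pow {S : Set (Perm α)} (h1 : 1 ∈ S)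
    (hS : ∀ g ∈ alternatingGroup α, ∀ y ∈ S, g * y * g⁻¹ ∈ S) {e : ℕ} {r : Perm α}
    (hr : r * r = 1) (hre : r.support.card = 4 * e) (hrS : r ∈ S ^ 2) (he : 1 ≤ e)
    (hα : 6 ≤ Fintype.card α) {c : ℕ} {τ : Perm α} (hτ : sign τ = 1)
    (hsupp : τ.support.card ≤ 4 * (c * e)) : τ ∈ S ^ (8 * c + 8) := by
  have hinv := involution_mem_pow h1 hS hr hre hrS
  obtain ⟨u, v, hu, hv, rfl, hus, hvs⟩ := exists_eq_mul_involutions τ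
  have hsub : ∀ w : Perm α, (∀ x, (u * v) x = x → w x = x) →
      w.support.card ≤ 4 * (c * e) := fun w hw =>
    (Finset.card_le_card fun x hx => by
      rw [mem_support] at hx ⊢
      exact fun h => hx (hw x h)).trans hsupp
  have hu4 := hsub u hus
  have hv4 := hsub v hvs
  have huc := (cycleType_of_sq_eq_one hu).2
  have hvc := (cycleType_of_sq_eq_one hv).2
  have hsu := sign_of_sq_eq_one hu huc
  have hsv := sign_of_sq_eq_one hv hvc
  generalize u.cycleType.card = k at *
  generalize v.cycleType.card = l at *
  rw [map_mul, hsu, hsv, ← pow_add, Int.units_pow_eq_pow_mod_two] at hτ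
  have hkl : (k + l) % 2 = 0 := by
    rcases Nat.mod_two_eq_zero_or_one (k + l) with h | h
    · exact h
    · rw [h] at hτ
      exact absurd hτ (by decide)
  rcases Nat.even_or_odd' k with ⟨k', rfl | rfl⟩
  · obtain ⟨l', rfl⟩ : ∃ l', l = 2 * l' := ⟨l / 2, by omega⟩
    refine Set.pow_subset_pow_right h1 (show 4 * c + 4 * c ≤ _ by omega) ?_
    rw [pow_add]
    exact Set.mul_mem_mul (hinv c k' u hu (by omega) (by omega))
      (hinv c l' v hv (by omega) (by omega))
  · obtain ⟨l', rfl⟩ : ∃ l', l = 2 * l' + 1 := ⟨l / 2, by omega⟩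
    obtain ⟨u', t, hu', ht, hu'c, htc, rfl⟩ := exists_eq_mul_of_add (k := 2 * k') (l := 1) hu
      (by omega)
    obtain ⟨t', v', ht', hv', ht'c, hv'c, rfl⟩ := exists_eq_mul_of_add (k := 1) (l := 2 * l') hv
      (by omega)
    -- Two points off the at most four points moved by `t` and `t'`. Inserting `w * w = 1` with `w =
    -- swap a b` turns `t * t'` into `(t * w) * (w * t')`.
    obtain ⟨a, ha, b, hb, hab⟩ : ∃ a ∈ (t.support ∪ t'.support)ᶜ, ∃ b ∈ (t.support ∪ t'.support)ᶜ,
        a ≠ b := by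
      rw [← Finset.one_lt_card, Finset.card_compl]
      have := Finset.card_union_le t.support t'.support
      omega
    let w : Perm α := swap a b
    have hww : w * w = 1 := swap_mul_self a b
    have hdis : ∀ s : Perm α, s.support ⊆ t.support ∪ t'.support → s.Disjoint w := by
      intro s hs
      rw [disjoint_iff_disjoint_support, support_swap hab, Finset.disjoint_insert_right,
        Finset.disjoint_singleton_right]
      exact ⟨fun h => Finset.mem_compl.1 ha (hs h), fun h => Finset.mem_compl.1 hb (hs h)⟩
    have h1e : 1 ≤ 1 * e := by omega
    have htw := hdis t Finset.subset_union_left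
    have ht'w := hdis t' Finset.subset_union_right
    have hm1 : t * w ∈ S ^ (4 * 1) := by
      refine hinv 1 1 (t * w) ?_ ?_ h1e
      · rw [htw.symm.commute.mul_mul_mul_comm, ht, hww, one_mul]
      · rw [htw.card_support_mul, htc, card_support_swap hab]
    have hm2 : w * t' ∈ S ^ (4 * 1) := by
      refine hinv 1 1 (w * t') ?_ ?_ h1e
      · rw [ht'w.commute.mul_mul_mul_comm, ht', hww, one_mul]
      · rw [ht'w.symm.card_support_mul, ht'c, card_support_swap hab]
    have hm3 := hinv c k' u' hu' (by omega) (by omega)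
    have hm4 := hinv c l' v' hv' (by omega) (by omega)
    have heq : u' * t * (t' * v') = u' * (t * w) * (w * t') * v' := by
      calc u' * t * (t' * v') = u' * t * 1 * t' * v' := by group
        _ = _ := by rw [← hww]; group
    rw [heq, show 8 * c + 8 = 4 * c + 4 * 1 + 4 * 1 + 4 * c by ring, pow_add, pow_add, pow_add]
    exact Set.mul_mem_mul (Set.mul_mem_mul (Set.mul_mem_mul hm3 hm1) hm2) hm4

/-- The products of two conjugates, by even permutations, of `σ` and `σ⁻¹`. -/
def evenPairs (σ : Perm α) : Set (Perm α) :=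
  {p | ∃ y ∈ alternatingGroup α, ∃ z ∈ alternatingGroup α,
    p = y * σ * y⁻¹ * (z * σ⁻¹ * z⁻¹)}

theorem one_mem_evenPairs (σ : Perm α) : 1 ∈ evenPairs σ :=
  ⟨1, one_mem _, 1, one_mem _, by simp⟩

theorem conj_mem_evenPairs (σ g : Perm α) (hg : g ∈ alternatingGroup α) (p : Perm α)
    (hp : p ∈ evenPairs σ) : g * p * g⁻¹ ∈ evenPairs σ := by
  obtain ⟨y, hy, z, hz, rfl⟩ := hp
  exact ⟨g * y, mul_mem hg hy, g * z, mul_mem hg hz, by group⟩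

theorem commutator_mem_evenPairs (σ y : Perm α) (hy : y ∈ alternatingGroup α) :
    y * (σ * y⁻¹ * σ⁻¹) ∈ evenPairs σ :=
  ⟨y, hy, 1, one_mem _, by group⟩

/-- For a maximal `B` disjoint from its image, each moved point lies in `B`, `σ B` or `σ⁻¹ B`;
otherwise it could be added. -/
theorem exists_card_le_three_mul (σ : Perm α) :
    ∃ B : Finset α, (∀ b ∈ B, σ b ∉ B) ∧ σ.support.card ≤ 3 * B.card := by
  classical
  obtain ⟨B, hB, hmax⟩ := Finset.exists_max_image
    (Finset.univ.filter fun B : Finset α => ∀ b ∈ B, σ b ∉ B) Finset.card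
    ⟨∅, by simp⟩
  have hB : ∀ b ∈ B, σ b ∉ B := (Finset.mem_filter.1 hB).2
  refine ⟨B, hB, ?_⟩
  have hcov : σ.support ⊆ B ∪ B.map σ.toEmbedding ∪ B.map σ⁻¹.toEmbedding := by
    intro x hx
    by_contra hcon
    simp only [Finset.mem_union, Finset.mem_map_equiv, not_or] at hcon
    obtain ⟨⟨h1, h2⟩, h3⟩ := hcon
    have h3 : σ x ∉ B := h3
    rw [mem_support] at hx
    have := hmax (insert x B) (by
      simp only [Finset.mem_filter, Finset.mem_univ, true_and, Finset.mem_insert]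
      rintro b (rfl | hb) (h | h)
      · exact hx h
      · exact h3 h
      · apply h2
        rw [← h, symm_apply_apply]
        exact hb
      · exact hB b hb h)
    rw [Finset.card_insert_of_notMem h1] at this
    omega
  have h1 := Finset.card_le_card hcov
  have h2 := Finset.card_union_le (B ∪ B.map σ.toEmbedding) (B.map σ⁻¹.toEmbedding)
  have h3 := Finset.card_union_le B (B.map σ.toEmbedding)
  rw [Finset.card_map] at h2 h3
  omega

/-- If `y` is an involution supported in a set `B` disjoint from `σ B`, its commutator with `σ` is a
product of two disjoint involutions. The bound 10 forces `4 ≤ B.card`, and rounding `B.card` down to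
a multiple of 4 costs the factor 11. -/
theorem exists_involution_of_ten_le {σ : Perm α} (hσ : 10 ≤ σ.support.card) :
    ∃ (e : ℕ) (r : Perm α), 1 ≤ e ∧ σ.support.card ≤ 11 * e ∧ r * r = 1 ∧
      r.support.card = 4 * e ∧ r ∈ evenPairs σ := by
  obtain ⟨B, hB, hcard⟩ := exists_card_le_three_mul σ
  obtain ⟨Ψ, hΨ⟩ := exists_blocks 4 (B.card / 4) B (by omega)
  let x : Perm (Fin 4) := swap 0 1 * swap 2 3
  have hx : x * x = 1 := by decide
  have hxc : x.support.card = 4 := by decide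
  let y := Ψ fun _ => x
  have hyy : y * y = 1 := by
    rw [← map_mul, ← map_one Ψ]
    congr 1
    exact funext fun _ => hx
  have hyc : y.support.card = 4 * (B.card / 4) := by
    rw [(hΨ _).2]
    simp [hxc, mul_comm]
  have hysub : y.support ⊆ B := (hΨ _).1
  have hyalt : y ∈ alternatingGroup α := by
    rw [mem_alternatingGroup, sign_of_sq_eq_one hyy (k := 2 * (B.card / 4)) (by omega), pow_mul]
    simp
  have hyinv : y⁻¹ = y := inv_eq_of_mul_eq_one_right hyy
  have hdis : y.Disjoint (σ * y * σ⁻¹) := by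
    rw [disjoint_iff_disjoint_support, support_conj, Finset.disjoint_right]
    intro z hz hz2
    obtain ⟨b, hb, rfl⟩ := Finset.mem_map.1 hz
    exact hB b (hysub hb) (hysub hz2)
  refine ⟨2 * (B.card / 4), y * (σ * y * σ⁻¹), by omega, by omega, ?_, ?_, ?_⟩
  · rw [hdis.symm.commute.mul_mul_mul_comm, conj_mul, hyy]
    simp
  · rw [hdis.card_support_mul, card_support_conj, hyc]
    ring
  · have := commutator_mem_evenPairs σ y hyalt
    rwa [hyinv] at this

/-- For small support, a commutator with `σ` is a 3-cycle. All 3-cycles are conjugate by even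
permutations, and two suitable ones multiply to a double transposition. -/
theorem exists_involution_of_le_nine {σ : Perm α} (hσ : σ ≠ 1) (h9 : σ.support.card ≤ 9)
    (hα : 13 ≤ Fintype.card α) :
    ∃ r : Perm α, r * r = 1 ∧ r.support.card = 4 ∧ r ∈ evenPairs σ ^ 2 := by
  obtain ⟨a, ha⟩ : ∃ a, σ a ≠ a := by
    by_contra! hcon
    exact hσ (Equiv.ext hcon)
  obtain ⟨f, hf, g, hg, h, hh, hfg, hfh, hgh⟩ : ∃ f ∈ σ.supportᶜ, ∃ g ∈ σ.supportᶜ,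
      ∃ h ∈ σ.supportᶜ, f ≠ g ∧ f ≠ h ∧ g ≠ h := by
    have : 2 < σ.supportᶜ.card := by
      rw [Finset.card_compl]; omega
    obtain ⟨f, g, h, h1, h2, h3, h4⟩ := Finset.two_lt_card_iff.1 this
    exact ⟨f, h1, g, h2, h, h3, h4⟩
  obtain ⟨b, hb⟩ : ∃ b, σ a = b := ⟨_, rfl⟩
  have hbs : b ∈ σ.support := by
    rw [← hb, apply_mem_support, mem_support]; exact ha
  have has : a ∈ σ.support := mem_support.2 ha
  have hne : ∀ p ∈ σ.support, ∀ q ∈ σ.supportᶜ, p ≠ q := fun p hp q hq hpq =>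
    Finset.mem_compl.1 hq (hpq ▸ hp)
  have hfix : ∀ q ∈ σ.supportᶜ, σ q = q := fun q hq => notMem_support.1 (Finset.mem_compl.1 hq)
  have hab : a ≠ b := fun h => ha (hb.trans h.symm)
  have haf := hne a has f hf
  have hag := hne a has g hg
  have hbf := hne b hbs f hf
  have hbg := hne b hbs g hg
  -- The factor `swap g h` only makes `y` even: it moves fixed points of `σ`, so it cancels in the
  -- commutator.
  let y : Perm α := swap a f * swap g h
  have hy : y ∈ alternatingGroup α := by
    rw [mem_alternatingGroup, map_mul, sign_swap haf, sign_swap hgh]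
    simp
  have hr0 : swap f a * swap f b ∈ evenPairs σ := by
    have h1 := commutator_mem_evenPairs σ y hy
    have h2 : y * (σ * y⁻¹ * σ⁻¹) = swap f a * swap f b := by
      rw [mul_inv_rev, swap_inv, swap_inv, ← mul_assoc σ, mul_swap_eq_swap_mul σ g h,
        mul_assoc _ σ, mul_swap_eq_swap_mul, hfix g hg, hfix h hh, hfix f hf, hb]
      calc swap a f * swap g h * (swap g h * (swap b f * σ) * σ⁻¹)
          = swap a f * (swap g h * swap g h) * swap b f := by group
        _ = swap f a * swap f b := by rw [swap_mul_self, mul_one, swap_comm a, swap_comm b]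
    rwa [h2] at h1
  have hc0 : IsThreeCycle (swap f a * swap f b) :=
    isThreeCycle_swap_mul_swap_same haf.symm hbf.symm hab
  have hc1 : IsThreeCycle (swap b f * swap b g) := isThreeCycle_swap_mul_swap_same hbf hbg hfg
  have hr1 : swap b f * swap b g ∈ evenPairs σ := by
    obtain ⟨k, hk⟩ := isConj_iff.1 (alternatingGroup.isThreeCycle_isConj
      (by rw [Nat.card_eq_fintype_card]; omega)
      (σ := ⟨_, hc0.mem_alternatingGroup⟩) (τ := ⟨_, hc1.mem_alternatingGroup⟩) hc0 hc1)
    have hk' : (k : Perm α) * (swap f a * swap f b) * (k : Perm α)⁻¹ = swap b f * swap b g :=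
      congrArg Subtype.val hk
    rw [← hk']
    exact conj_mem_evenPairs σ k k.2 _ hr0
  have hdis : (swap f a).Disjoint (swap b g) := by
    rw [disjoint_iff_disjoint_support, support_swap haf.symm, support_swap hbg]
    simp [hab.symm, hag.symm, hfg.symm, hbf]
  refine ⟨swap f a * swap b g, ?_, ?_, ?_⟩
  · rw [hdis.symm.commute.mul_mul_mul_comm, swap_mul_self, swap_mul_self, one_mul]
  · rw [hdis.card_support_mul, card_support_swap haf.symm, card_support_swap hbg]
  · have heq : swap f a * swap b g = swap f a * swap f b * (swap b f * swap b g) := by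
      rw [swap_comm b f, mul_assoc, swap_mul_self_mul]
    rw [heq, pow_two]
    exact Set.mul_mem_mul hr0 hr1

/-- Bounded generation of the alternating groups, uniform in the degree: an even permutation whose
support is at most `C` times that of `σ` is a product of boundedly many pairs of conjugates of `σ`
and `σ⁻¹`. -/
theorem mem_evenPairs_pow (hα : 13 ≤ Fintype.card α) {σ τ : Perm α} (hτ : sign τ = 1)
    {C : ℕ} (h : τ.support.card ≤ C * σ.support.card) :
    τ ∈ evenPairs σ ^ (24 * C + 16) := by
  by_cases hσ : σ = 1
  · have : τ = 1 := by
      rw [← card_support_eq_zero]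
      simpa [hσ] using h
    rw [this]
    exact Set.one_mem_pow (one_mem_evenPairs σ)
  obtain ⟨e, r, he, hle, hrr, hrc, hr⟩ : ∃ (e : ℕ) (r : Perm α), 1 ≤ e ∧
      σ.support.card ≤ 11 * e ∧ r * r = 1 ∧ r.support.card = 4 * e ∧ r ∈ evenPairs σ ^ 2 := by
    by_cases h10 : 10 ≤ σ.support.card
    · obtain ⟨e, r, h1, h2, h3, h4, h5⟩ := exists_involution_of_ten_le h10
      exact ⟨e, r, h1, h2, h3, h4,
        Set.pow_subset_pow_right (one_mem_evenPairs σ) one_le_two (by rwa [pow_one])⟩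
    · obtain ⟨r, h3, h4, h5⟩ := exists_involution_of_le_nine hσ (by omega) hα
      exact ⟨1, r, le_rfl, by omega, h3, h4, h5⟩
  -- With `c = 3 * C + 1`, the support of `τ` has at most `11 * C * e ≤ 4 * c * e` points.
  rw [show 24 * C + 16 = 8 * (3 * C + 1) + 8 by ring]
  refine even_mem_pow (one_mem_evenPairs σ) (conj_mem_evenPairs σ) hrr hrc hr he (by omega)
    hτ ?_
  have := Nat.mul_le_mul_left C hle
  nlinarith

end Generation

/-! ### Hamming length and product actions. -/

section Moved

variable {α β : Type*}

/-- The proportion of the points that are moved by a permutation. -/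
noncomputable def moved (σ : Equiv.Perm α) : ℝ := Nat.card {x // σ x ≠ x} / Nat.card α

theorem moved_eq [Fintype α] [DecidableEq α] (σ : Equiv.Perm α) :
    moved σ = σ.support.card / Fintype.card α := by
  rw [moved, Nat.card_eq_fintype_card, Nat.card_eq_fintype_card, Fintype.card_subtype]
  rfl

theorem hammingLength_toFun {m : ℕ} (σ : Equiv.Perm (Fin m)) :
    (hammingLength m).toFun σ = moved σ := by
  rw [moved_eq, Fintype.card_fin]
  rfl

theorem moved_nonneg (σ : Equiv.Perm α) : 0 ≤ moved σ := by
  unfold moved; positivity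

theorem moved_le_one [Finite α] (σ : Equiv.Perm α) : moved σ ≤ 1 := by
  refine div_le_one_of_le₀ ?_ (Nat.cast_nonneg _)
  exact_mod_cast Nat.card_le_card_of_injective _ Subtype.val_injective

theorem moved_one : moved (1 : Equiv.Perm α) = 0 := by
  simp [moved]

theorem moved_inv [Finite α] (σ : Equiv.Perm α) : moved σ⁻¹ = moved σ := by
  classical
  have := Fintype.ofFinite α
  rw [moved_eq, moved_eq, Equiv.Perm.support_inv]

theorem moved_mul_le [Finite α] (σ τ : Equiv.Perm α) : moved (σ * τ) ≤ moved σ + moved τ := by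
  classical
  have := Fintype.ofFinite α
  rw [moved_eq, moved_eq, moved_eq, ← add_div]
  refine div_le_div_of_nonneg_right ?_ (Nat.cast_nonneg _)
  exact_mod_cast (Finset.card_le_card (Equiv.Perm.support_mul_le σ τ)).trans
    (Finset.card_union_le _ _)

theorem moved_conj [Finite α] (σ τ : Equiv.Perm α) : moved (τ⁻¹ * σ * τ) = moved σ := by
  classical
  have := Fintype.ofFinite α
  have h := Equiv.Perm.card_support_conj (σ := τ⁻¹) (τ := σ)
  rw [inv_inv] at h
  rw [moved_eq, moved_eq, h]

theorem moved_permCongr (e : α ≃ β) (σ : Equiv.Perm α) : moved (e.permCongr σ) = moved σ := by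
  unfold moved
  rw [Nat.card_congr e]
  congr 2
  refine Nat.card_congr (e.subtypeEquiv fun x => ?_).symm
  simp [Equiv.permCongr_apply]

theorem one_sub_moved [Fintype α] [DecidableEq α] [Nonempty α] (σ : Equiv.Perm α) :
    1 - moved σ = ((Finset.univ.filter fun x => σ x = x).card : ℝ) / Fintype.card α := by
  have h1 : ((Finset.univ.filter fun x => σ x = x).card : ℝ) + σ.support.card =
      Fintype.card α := by
    exact_mod_cast Finset.card_filter_add_card_filter_not (s := Finset.univ) (fun x => σ x = x)
  have h2 : (Fintype.card α : ℝ) ≠ 0 := by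
    exact_mod_cast Fintype.card_ne_zero
  rw [moved_eq, eq_div_iff h2, sub_mul, div_mul_cancel₀ _ h2, ← h1]
  ring

/-- The product action. -/
def piPerm {T : Type*} (Ω : T → Type*) : (∀ t, Equiv.Perm (Ω t)) →* Equiv.Perm (∀ t, Ω t) where
  toFun σ := Equiv.piCongrRight σ
  map_one' := rfl
  map_mul' _ _ := rfl

/-- The fixed points of the product action form the product of the fixed point sets. -/
theorem one_sub_moved_piPerm {T : Type*} [Fintype T] (Ω : T → Type*) [∀ t, Finite (Ω t)]
    [∀ t, Nonempty (Ω t)] (σ : ∀ t, Equiv.Perm (Ω t)) :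
    1 - moved (piPerm Ω σ) = ∏ t, (1 - moved (σ t)) := by
  classical
  have := fun t => Fintype.ofFinite (Ω t)
  simp only [one_sub_moved]
  rw [Finset.prod_div_distrib, Fintype.card_pi, ← Nat.cast_prod, ← Nat.cast_prod,
    ← Fintype.card_piFinset]
  congr 3
  ext x
  simp only [Finset.mem_filter, Finset.mem_univ, true_and, Fintype.mem_piFinset]
  exact funext_iff

theorem moved_piPerm_le_sum {T : Type*} [Fintype T] (Ω : T → Type*) [∀ t, Finite (Ω t)]
    [∀ t, Nonempty (Ω t)] (σ : ∀ t, Equiv.Perm (Ω t)) :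
    moved (piPerm Ω σ) ≤ ∑ t, moved (σ t) := by
  classical
  have key : ∀ s : Finset T, 1 - ∑ t ∈ s, moved (σ t) ≤ ∏ t ∈ s, (1 - moved (σ t)) ∧
      ∏ t ∈ s, (1 - moved (σ t)) ≤ 1 := by
    intro s
    induction s using Finset.induction_on with
    | empty => simp
    | insert a s ha ih =>
      rw [Finset.sum_insert ha, Finset.prod_insert ha]
      have h1 := moved_nonneg (σ a)
      have h2 := moved_le_one (σ a)
      constructor <;> nlinarith [ih.1, ih.2]
  have := (key Finset.univ).1
  rw [← one_sub_moved_piPerm] at this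
  linarith

theorem le_moved_piPerm {T : Type*} [Fintype T] (Ω : T → Type*) [∀ t, Finite (Ω t)]
    [∀ t, Nonempty (Ω t)] (σ : ∀ t, Equiv.Perm (Ω t)) (t : T) :
    moved (σ t) ≤ moved (piPerm Ω σ) := by
  classical
  have h1 : ∏ t, (1 - moved (σ t)) ≤ 1 - moved (σ t) := by
    rw [← Finset.mul_prod_erase _ _ (Finset.mem_univ t)]
    exact mul_le_of_le_one_right (by linarith [moved_le_one (σ t)])
      (Finset.prod_le_one (fun i _ => by linarith [moved_le_one (σ i)])
        fun i _ => by linarith [moved_nonneg (σ i)])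
  rw [← one_sub_moved_piPerm] at h1
  linarith

end Moved

/-! ### Sofic groups are approximable by symmetric and by alternating groups. -/

section Sofic

/-- A criterion for being sofic, without universe constraints and with the bound `1 / 2`. -/
theorem isSofic_of_perm {G : Type u} [Group G]
    (h : ∀ (Φ : Finset G) (ε : ℝ), 0 < ε → ∃ (Ω : Type u) (_ : Finite Ω) (_ : Nonempty Ω)
      (ψ : G → Equiv.Perm Ω), ψ 1 = 1 ∧ (∀ g ∈ Φ, g ≠ 1 → 1 / 2 ≤ moved (ψ g)) ∧
      ∀ g ∈ Φ, ∀ h ∈ Φ, g * h ∈ Φ → moved (ψ g * ψ h * (ψ (g * h))⁻¹) < ε) :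
    IsSofic G := by
  classical
  refine ⟨fun g => if g = 1 then 0 else 1 / 2, if_pos rfl, fun g hg => by simp [hg], ?_⟩
  intro Φ ε hε
  obtain ⟨Ω, _, _, ψ, h1, h2, h3⟩ := h Φ ε hε
  let e : Ω ≃ Fin (Nat.card Ω) := Finite.equivFin Ω
  let E : Equiv.Perm Ω ≃* Equiv.Perm (Fin (Nat.card Ω)) := e.permCongrHom
  let f : ULift.{u} (Equiv.Perm (Fin (Nat.card Ω))) ≃* Equiv.Perm (Fin (Nat.card Ω)) :=
    MulEquiv.ulift
  have hpos : 0 < Nat.card Ω := Nat.card_pos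
  have hE : ∀ σ, (hammingLength (Nat.card Ω)).toFun (E σ) = moved σ := fun σ => by
    rw [hammingLength_toFun]
    exact moved_permCongr e σ
  refine ⟨ULift.{u} (Equiv.Perm (Fin (Nat.card Ω))), inferInstance, fun g => f.symm (E (ψ g)),
    (hammingLength (Nat.card Ω)).comap f.toMonoidHom, ⟨_, hpos, ⟨f⟩⟩, ⟨_, hpos, f, rfl⟩,
    by simp [h1], ?_, ?_⟩
  · intro g hg
    change (if g = 1 then (0 : ℝ) else 1 / 2) ≤
      (hammingLength (Nat.card Ω)).toFun (f (f.symm (E (ψ g))))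
    rw [MulEquiv.apply_symm_apply, hE]
    by_cases hg1 : g = 1
    · rw [if_pos hg1]
      exact moved_nonneg _
    · rw [if_neg hg1]
      exact h2 g hg hg1
  · intro g hg h hh hgh
    change (hammingLength (Nat.card Ω)).toFun (f (_ * (_ * _)⁻¹)) < ε
    -- The defect in `IsSofic` is the inverse of the one in `defects`; `moved_inv` identifies their
    -- lengths.
    rw [← map_mul, ← map_mul, ← map_inv, ← map_inv, ← map_mul, ← map_mul,
      MulEquiv.apply_symm_apply, hE, ← moved_inv, mul_inv_rev, inv_inv]
    exact h3 g hg h hh hgh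

/-- Separation of the images of the nontrivial elements, for a `φ` with small defects. -/
theorem moved_le_of_mem_conjSet_pow {H : Type*} [Group H] {Ω : Type*} [Finite Ω]
    (f : H →* Equiv.Perm Ω) {X : Set H} {ε : ℝ} (hX : ∀ x ∈ X, moved (f x) ≤ ε) :
    ∀ (n : ℕ) (y : H), y ∈ conjSet X ^ n → moved (f y) ≤ n * ε
  | 0, y, hy => by
    rw [pow_zero, Set.mem_one] at hy
    simp [hy, moved_one]
  | n + 1, y, hy => by
    rw [pow_succ] at hy
    obtain ⟨a, ha, _, ⟨x, g, hx, rfl⟩, rfl⟩ := hy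
    have h1 := moved_le_of_mem_conjSet_pow f hX n a ha
    have h2 : moved (f (g⁻¹ * x * g)) ≤ ε := by
      rw [map_mul, map_mul, map_inv, moved_conj]
      rcases hx with hx | hx
      · exact hX x hx
      · have := hX _ hx
        rwa [map_inv, moved_inv] at this
    simp only [map_mul] at h2 ⊢
    refine (moved_mul_le _ _).trans ?_
    push_cast
    linarith

/-- On the nontrivial elements of `Φ` the function `α` has a positive lower bound `a`; the tolerance
`a / (n + 1)` leaves strict room for `n` defects. -/
theorem IsSofic.exists_perm {G : Type u} [Group G] (hG : IsSofic G) (Φ : Finset G) (n : ℕ) :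
    ∃ (m : ℕ) (φ : G → Equiv.Perm (Fin m)) (ε : ℝ), 0 < m ∧ φ 1 = 1 ∧
      (∀ x ∈ defects Φ φ, moved x ≤ ε) ∧ ∀ g ∈ Φ, g ≠ 1 → n * ε < moved (φ g) := by
  classical
  obtain ⟨α, -, hα, h⟩ := hG
  obtain ⟨a, ha, hle⟩ : ∃ a : ℝ, 0 < a ∧ ∀ g ∈ Φ, g ≠ 1 → a ≤ α g := by
    rcases (Φ.filter (· ≠ 1)).eq_empty_or_nonempty with he | hne
    · refine ⟨1, one_pos, fun g hg hg1 => ?_⟩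
      have : g ∈ Φ.filter (· ≠ 1) := Finset.mem_filter.2 ⟨hg, hg1⟩
      simp [he] at this
    · obtain ⟨g₀, hg₀, hmin⟩ := Finset.exists_min_image _ α hne
      exact ⟨α g₀, hα g₀ (Finset.mem_filter.1 hg₀).2,
        fun g hg hg1 => hmin g (Finset.mem_filter.2 ⟨hg, hg1⟩)⟩
  obtain ⟨H, _, φ, ℓ, -, ⟨m, hm, e, rfl⟩, hφ1, h2, h3⟩ := h Φ (a / (n + 1)) (by positivity)
  have hℓ : ∀ x, ((hammingLength m).comap e.toMonoidHom).toFun x = moved (e x) := fun x =>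
    hammingLength_toFun (e x)
  simp only [hℓ] at h2 h3
  refine ⟨m, fun g => e (φ g), a / (n + 1), hm, by simp [hφ1], ?_, fun g hg hg1 => ?_⟩
  · rintro _ ⟨g, h, hg, hh, hgh, rfl⟩
    have := h3 g hg h hh hgh
    rw [← moved_inv, ← map_inv, mul_inv_rev, inv_inv, map_mul, map_mul, map_inv] at this
    exact this.le
  · refine lt_of_lt_of_le ?_ ((hle g hg hg1).trans (h2 g hg))
    rw [mul_div_assoc', div_lt_iff₀ (by positivity)]
    nlinarith

theorem IsSofic.sym_approx {G : Type u} [Group G] (hG : IsSofic G) :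
    GroupClass.sym.{u}.approx G := by
  rw [GroupClass.approx_iff]
  intro Φ n
  obtain ⟨m, φ, ε, hm, hφ1, hε, hlt⟩ := hG.exists_perm Φ n
  let f : ULift.{u} (Equiv.Perm (Fin m)) ≃* Equiv.Perm (Fin m) := MulEquiv.ulift
  refine ⟨ULift.{u} (Equiv.Perm (Fin m)), inferInstance, fun g => f.symm (φ g), ⟨m, hm, ⟨f⟩⟩,
    by simp [hφ1], fun g hg hg1 hmem => ?_⟩
  have := moved_le_of_mem_conjSet_pow f.toMonoidHom (ε := ε) ?_ n _ hmem
  · exact (hlt g hg hg1).not_ge this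
  · rintro _ ⟨g, h, hg, hh, hgh, rfl⟩
    exact hε _ ⟨g, h, hg, hh, hgh, rfl⟩

/-- Doubling embeds a symmetric group into an alternating group. -/
def doublePerm (m : ℕ) : Equiv.Perm (Fin m) →* Equiv.Perm (Fin (m + m)) :=
  (finSumFinEquiv.permCongrHom.toMonoidHom.comp (Equiv.Perm.sumCongrHom (Fin m) (Fin m))).comp
    ((MonoidHom.id _).prod (MonoidHom.id _))

theorem doublePerm_mem (m : ℕ) (σ : Equiv.Perm (Fin m)) :
    doublePerm m σ ∈ alternatingGroup (Fin (m + m)) := by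
  rw [Equiv.Perm.mem_alternatingGroup]
  change Equiv.Perm.sign (finSumFinEquiv.permCongr (Equiv.Perm.sumCongr σ σ)) = 1
  rw [Equiv.Perm.sign_permCongr, Equiv.Perm.sign_sumCongr, Int.units_mul_self]

theorem moved_doublePerm (m : ℕ) (σ : Equiv.Perm (Fin m)) : moved (doublePerm m σ) = moved σ := by
  refine (moved_permCongr finSumFinEquiv (Equiv.Perm.sumCongr σ σ)).trans ?_
  have e : {x // Equiv.Perm.sumCongr σ σ x ≠ x} ≃ {x // σ x ≠ x} ⊕ {x // σ x ≠ x} :=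
    (Equiv.subtypeSum).trans (Equiv.sumCongr
      (Equiv.subtypeEquivRight fun x => by simp) (Equiv.subtypeEquivRight fun x => by simp))
  rw [moved, moved, Nat.card_congr e, Nat.card_sum, Nat.card_sum, ← two_mul, ← two_mul]
  push_cast
  rw [mul_div_mul_left _ _ two_ne_zero]

theorem IsSofic.alt_approx {G : Type u} [Group G] (hG : IsSofic G) :
    GroupClass.alt.{u}.approx G := by
  rw [GroupClass.approx_iff]
  intro Φ n
  obtain ⟨m, φ, ε, hm, hφ1, hε, hlt⟩ := hG.exists_perm Φ n
  let f : ULift.{u} (alternatingGroup (Fin (m + m))) ≃* alternatingGroup (Fin (m + m)) :=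
    MulEquiv.ulift
  let d : Equiv.Perm (Fin m) →* alternatingGroup (Fin (m + m)) :=
    (doublePerm m).codRestrict _ (doublePerm_mem m)
  have hd : ∀ σ, moved (d σ : Equiv.Perm (Fin (m + m))) = moved σ := moved_doublePerm m
  refine ⟨ULift.{u} (alternatingGroup (Fin (m + m))), inferInstance, fun g => f.symm (d (φ g)),
    ⟨m + m, by omega, ⟨f⟩⟩, by simp [hφ1], fun g hg hg1 hmem => ?_⟩
  have := moved_le_of_mem_conjSet_pow ((alternatingGroup (Fin (m + m))).subtype.comp f.toMonoidHom)
    (ε := ε) ?_ n _ hmem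
  · exact (hlt g hg hg1).not_ge ((hd _).symm.trans_le this)
  · rintro _ ⟨g, h, hg, hh, hgh, rfl⟩
    refine le_trans (le_of_eq ?_) (hε _ ⟨g, h, hg, hh, hgh, rfl⟩)
    rw [← hd]
    simp

end Sofic

/-! ### Pairs of conjugates in direct products. -/

section PairConsequences

variable {ι : Type*}

/-- The products of a conjugate of some `x i` and a conjugate of its inverse. -/
def conjPairs {H : Type*} [Group H] (x : ι → H) : Set H :=
  {p | ∃ (i : ι) (y z : H), p = y * x i * y⁻¹ * (z * (x i)⁻¹ * z⁻¹)}

theorem one_mem_conjPairs {H : Type*} [Group H] (x : ι → H) (i : ι) : 1 ∈ conjPairs x :=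
  ⟨i, 1, 1, by simp⟩

theorem inv_mem_conjPairs {H : Type*} [Group H] (x : ι → H) {p : H} (hp : p ∈ conjPairs x) :
    p⁻¹ ∈ conjPairs x := by
  obtain ⟨i, y, z, rfl⟩ := hp
  exact ⟨i, z, y, by group⟩

theorem conj_mem_conjPairs {H : Type*} [Group H] (x : ι → H) (g : H) {p : H}
    (hp : p ∈ conjPairs x) : g * p * g⁻¹ ∈ conjPairs x := by
  obtain ⟨i, y, z, rfl⟩ := hp
  exact ⟨i, g * y, g * z, by group⟩

instance {H : Type*} [Group H] (x : ι → H) : (Subgroup.closure (conjPairs x)).Normal := by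
  refine ⟨fun y hy g => ?_⟩
  induction hy using Subgroup.closure_induction with
  | mem p hp => exact Subgroup.subset_closure (conj_mem_conjPairs x g hp)
  | one => simp
  | mul a b _ _ ha hb => simpa using mul_mem ha hb
  | inv a _ ha => simpa [mul_assoc] using inv_mem ha

/-- The powers of a set containing `1` increase, and their size is constant from exponent `Nat.card
H` on. -/
theorem mem_pow_of_mem_closure {H : Type*} [Group H] [Finite H] {S : Set H} (h1 : 1 ∈ S)
    (hinv : ∀ s ∈ S, s⁻¹ ∈ S) {y : H} (hy : y ∈ Subgroup.closure S) {L : ℕ}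
    (hL : Nat.card H ≤ L) : y ∈ S ^ L := by
  classical
  have := Fintype.ofFinite H
  have hSinv : S⁻¹ = S := by
    ext s
    exact ⟨fun h => by simpa using hinv _ h, fun h => hinv _ h⟩
  obtain ⟨k, hk⟩ : ∃ k, y ∈ S ^ k := by
    induction hy using Subgroup.closure_induction with
    | mem p hp => exact ⟨1, by simpa using hp⟩
    | one => exact ⟨0, by simp⟩
    | mul a b _ _ ha hb =>
      obtain ⟨k, hk⟩ := ha
      obtain ⟨l, hl⟩ := hb
      exact ⟨k + l, by rw [pow_add]; exact Set.mul_mem_mul hk hl⟩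
    | inv a _ ha =>
      obtain ⟨k, hk⟩ := ha
      exact ⟨k, by rw [← hSinv, inv_pow]; simpa using hk⟩
  rw [Nat.card_eq_fintype_card] at hL
  have hle := Set.pow_subset_pow_right h1 (le_max_right k L)
  have heq : S ^ L = S ^ max k L := by
    refine Set.eq_of_subset_of_card_le hle (le_of_eq ?_)
    rw [Group.card_pow_eq_card_pow_card_univ S _ hL,
      Group.card_pow_eq_card_pow_card_univ S _ (hL.trans (le_max_right _ _))]
  rw [heq]
  exact Set.pow_subset_pow_right h1 (le_max_left k L) hk

/-- In a direct product, the coordinates of products of pairs can be chosen independently. -/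
theorem pi_mem_conjSet_pow {J : Type*} {H : J → Type*} [∀ j, Group (H j)] [Fintype ι]
    (x : ι → ∀ j, H j) {q : ∀ j, H j} (hq : ∀ j, q j ∈ conjPairs fun i => x i j) :
    q ∈ conjSet (Set.range x) ^ (2 * Fintype.card ι) := by
  classical
  have key : ∀ (s : Finset ι) (q : ∀ j, H j),
      (∀ j, q j = 1 ∨ ∃ i ∈ s, ∃ y z, q j = y * x i j * y⁻¹ * (z * (x i j)⁻¹ * z⁻¹)) →
      q ∈ conjSet (Set.range x) ^ (2 * s.card) := by
    intro s
    induction s using Finset.induction_on with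
    | empty =>
      intro q hq
      have : q = 1 := funext fun j => by simpa using hq j
      simp [this]
    | insert a s ha ih =>
      intro q hq
      let P : J → Prop := fun j => ∃ y z, q j = y * x a j * y⁻¹ * (z * (x a j)⁻¹ * z⁻¹)
      have hPc : ∀ j, ∃ y z : H j, P j → q j = y * x a j * y⁻¹ * (z * (x a j)⁻¹ * z⁻¹) := by
        intro j
        by_cases h : P j
        · obtain ⟨y, z, h⟩ := h
          exact ⟨y, z, fun _ => h⟩
        · exact ⟨1, 1, fun h' => absurd h' h⟩
      choose y z hyz using hPc
      -- In the coordinates not served by `a`, the conjugators are `1` and the pair collapses to `x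
      -- a j * (x a j)⁻¹ = 1`. Single conjugates could not be switched off in this way.
      let y' : ∀ j, H j := fun j => if P j then y j else 1
      let z' : ∀ j, H j := fun j => if P j then z j else 1
      let r : ∀ j, H j := fun j => if P j then 1 else q j
      have h1 : y' * x a * y'⁻¹ ∈ conjSet (Set.range x) :=
        ⟨x a, y'⁻¹, Or.inl ⟨a, rfl⟩, by simp⟩
      have h2 : z' * (x a)⁻¹ * z'⁻¹ ∈ conjSet (Set.range x) :=
        ⟨(x a)⁻¹, z'⁻¹, Or.inr ⟨a, by simp⟩, by simp⟩
      have h3 : r ∈ conjSet (Set.range x) ^ (2 * s.card) := by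
        refine ih r fun j => ?_
        by_cases h : P j
        · left; simp [r, h]
        · rcases hq j with h' | ⟨i, hi, h'⟩
          · left; simp [r, h']
          · rcases Finset.mem_insert.1 hi with rfl | hi
            · exact absurd h' h
            · right
              simp only [r, if_neg h]
              exact ⟨i, hi, h'⟩
      have h4 : q = y' * x a * y'⁻¹ * (z' * (x a)⁻¹ * z'⁻¹) * r := by
        funext j
        by_cases h : P j
        · simpa [y', z', r, h] using hyz j h
        · simp [y', z', r, h]
      rw [Finset.card_insert_of_notMem ha, show 2 * (s.card + 1) = 1 + 1 + 2 * s.card by ring,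
        pow_add, pow_add, pow_one, h4]
      exact Set.mul_mem_mul (Set.mul_mem_mul h1 h2) h3
  refine key Finset.univ q fun j => ?_
  obtain ⟨i, y, z, h⟩ := hq j
  exact Or.inr ⟨i, Finset.mem_univ i, y, z, h⟩

theorem pi_pow_mem_conjSet_pow {J : Type*} {H : J → Type*} [∀ j, Group (H j)] [Fintype ι]
    (x : ι → ∀ j, H j) : ∀ (N : ℕ) (q : ∀ j, H j),
    (∀ j, q j ∈ (conjPairs fun i => x i j) ^ N) →
    q ∈ conjSet (Set.range x) ^ (2 * Fintype.card ι * N)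
  | 0, q, hq => by
    have : q = 1 := funext fun j => by simpa using hq j
    simp [this]
  | N + 1, q, hq => by
    choose a ha b hb hab using fun j => Set.mem_mul.1 (by simpa only [pow_succ] using hq j)
    have h1 := pi_pow_mem_conjSet_pow x N a ha
    have h2 := pi_mem_conjSet_pow x hb
    rw [show q = a * b from funext fun j => (hab j).symm, mul_add_one, pow_add]
    exact Set.mul_mem_mul h1 h2

/-- Normal form in the subgroup generated by finitely many central elements of bounded
exponent. -/
theorem exists_exponents_of_mem_closure {Q : Type*} [Group Q] [Fintype ι] (x : ι → Q) {E : ℕ}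
    (hE : 0 < E) (hc : ∀ i, x i ∈ Subgroup.center Q) (hx : ∀ i, x i ^ E = 1) {y : Q}
    (hy : y ∈ Subgroup.closure (Set.range x)) :
    ∃ e : ι → ℕ, (∀ i, e i ≤ E) ∧
      y = ((Finset.univ : Finset ι).toList.map fun i => x i ^ e i).prod := by
  let _ : CommGroup (Subgroup.center Q) :=
    { (inferInstance : Group (Subgroup.center Q)) with
      mul_comm := fun a b => Subtype.ext (Subgroup.mem_center_iff.1 b.2 a) }
  let x' : ι → Subgroup.center Q := fun i => ⟨x i, hc i⟩
  have hrange : Set.range x = (Subgroup.center Q).subtype '' Set.range x' := by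
    rw [← Set.range_comp]; rfl
  rw [hrange, ← MonoidHom.map_closure] at hy
  obtain ⟨y', hy', rfl⟩ := hy
  obtain ⟨a, rfl⟩ := Subgroup.exists_of_mem_closure_range x' y' hy'
  have hE' : (E : ℤ) ≠ 0 := by exact_mod_cast hE.ne'
  refine ⟨fun i => (a i % E).toNat, fun i => ?_, ?_⟩
  · have := Int.emod_lt_of_pos (a i) (by exact_mod_cast hE : (0 : ℤ) < E)
    dsimp only
    omega
  · rw [← Finset.prod_map_toList, map_list_prod, List.map_map]
    congr 1
    refine List.map_congr_left fun i _ => ?_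
    have h1 : ((a i % E).toNat : ℤ) = a i % E := Int.toNat_of_nonneg (Int.emod_nonneg _ hE')
    change ((x' i ^ a i : Subgroup.center Q) : Q) = x i ^ (a i % E).toNat
    rw [← zpow_natCast, h1, Subgroup.coe_zpow]
    change x i ^ a i = _
    conv_lhs => rw [← Int.emod_add_mul_ediv (a i) E, zpow_add, zpow_mul, zpow_natCast, hx]
    simp

end PairConsequences

/-! ### A uniform bound in products of alternating or symmetric groups. -/

section LargeGroups

open Equiv Equiv.Perm

variable {ι : Type*}

theorem mem_conjPairs_pow_of_map_mem {H : Type*} [Group H] {m : ℕ} (f : H →* Perm (Fin m))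
    (hf : Function.Injective f) (hA : alternatingGroup (Fin m) ≤ f.range) (x : ι → H) (i : ι)
    {d : H} {N : ℕ} (hd : f d ∈ evenPairs (f (x i)) ^ N) : d ∈ conjPairs x ^ N := by
  have hsub : evenPairs (f (x i)) ⊆ f '' conjPairs x := by
    rintro _ ⟨y, hy, z, hz, rfl⟩
    obtain ⟨y, rfl⟩ := hA hy
    obtain ⟨z, rfl⟩ := hA hz
    exact ⟨_, ⟨i, y, z, rfl⟩, by simp⟩
  have h1 := Set.pow_subset_pow_left hsub hd
  rw [← Set.image_pow] at h1
  obtain ⟨d', hd', h2⟩ := h1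
  rwa [← hf h2]

theorem card_dvd_factorial {H : Type*} [Group H] {m : ℕ} (f : H →* Perm (Fin m))
    (hf : Function.Injective f) (hm : m ≤ 13) : Nat.card H ∣ Nat.factorial 13 := by
  have h1 := Subgroup.card_dvd_of_injective f hf
  rw [Nat.card_eq_fintype_card (α := Perm (Fin m)), Fintype.card_perm, Fintype.card_fin] at h1
  exact h1.trans (Nat.factorial_dvd_factorial hm)

/-- For `m ≤ 13` the order of `H` divides `13!`, so the powers have stabilised. For larger `m`
bounded generation applies: `d` is even because every pair is. -/
theorem exists_pow_bound (C : ℕ) : ∃ N : ℕ, ∀ {H : Type u} [Group H] {m : ℕ}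
    (f : H →* Perm (Fin m)), Function.Injective f → alternatingGroup (Fin m) ≤ f.range →
    ∀ {ι : Type u} (x : ι → H) (i : ι) (d : H), d ∈ Subgroup.closure (conjPairs x) →
    (f d).support.card ≤ C * (f (x i)).support.card → d ∈ conjPairs x ^ N := by
  refine ⟨Nat.factorial 13 + (24 * C + 16), ?_⟩
  intro H _ m f hf hA ι x i d hd hle
  have h1 := one_mem_conjPairs x i
  by_cases hm : m ≤ 13
  · have : Finite H := Finite.of_injective f hf
    refine Set.pow_subset_pow_right h1 (Nat.le_add_right _ _) ?_
    exact mem_pow_of_mem_closure h1 (fun s hs => inv_mem_conjPairs x hs) hd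
      (Nat.le_of_dvd (Nat.factorial_pos _) (card_dvd_factorial f hf hm))
  · refine Set.pow_subset_pow_right h1 (Nat.le_add_left _ _) ?_
    refine mem_conjPairs_pow_of_map_mem f hf hA x i ?_
    refine mem_evenPairs_pow (by rw [Fintype.card_fin]; omega) ?_ hle
    have : Subgroup.closure (conjPairs x) ≤ (sign.comp f).ker := by
      rw [Subgroup.closure_le]
      rintro _ ⟨i, y, z, rfl⟩
      change sign (f _) = 1
      simp only [map_mul, map_inv, mul_inv_cancel_comm, mul_inv_cancel]
    exact this hd

/-- For small `m` the exponent `13!` kills `H`. For large `m` it only has to be even: the power is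
then an even permutation, and the crude ratio `m` suffices since no bound on the number of factors
is needed. -/
theorem pow_factorial_mem_closure {H : Type*} [Group H] {m : ℕ} (f : H →* Perm (Fin m))
    (hf : Function.Injective f) (hA : alternatingGroup (Fin m) ≤ f.range) (x : ι → H) (i : ι) :
    x i ^ Nat.factorial 13 ∈ Subgroup.closure (conjPairs x) := by
  by_cases hm : m ≤ 13
  · obtain ⟨k, hk⟩ := card_dvd_factorial f hf hm
    rw [hk, pow_mul, pow_card_eq_one', one_pow]
    exact one_mem _
  · by_cases hx : x i = 1
    · rw [hx, one_pow]
      exact one_mem _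
    have hpos : 0 < (f (x i)).support.card := by
      rw [Nat.pos_iff_ne_zero, Ne, card_support_eq_zero]
      exact fun h => hx (hf (h.trans (map_one f).symm))
    have h1 : x i ^ Nat.factorial 13 ∈ conjPairs x ^ (24 * m + 16) := by
      refine mem_conjPairs_pow_of_map_mem f hf hA x i ?_
      refine mem_evenPairs_pow (by rw [Fintype.card_fin]; omega) ?_ ?_
      · obtain ⟨k, hk⟩ : 2 ∣ Nat.factorial 13 := Nat.dvd_factorial (by norm_num) (by norm_num)
        rw [hk, pow_mul, map_pow, map_pow, map_pow, map_pow, Int.units_sq, one_pow]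
      · calc _ ≤ m := by simpa using Finset.card_le_univ (f (x i ^ Nat.factorial 13)).support
          _ ≤ m * _ := Nat.le_mul_of_pos_right _ hpos
    have h2 : ∀ n : ℕ, conjPairs x ^ n ⊆ Subgroup.closure (conjPairs x) := by
      intro n
      induction n with
      | zero => simp [one_mem]
      | succ n ih =>
        rw [pow_succ]
        rintro _ ⟨a, ha, b, hb, rfl⟩
        exact mul_mem (ih ha) (Subgroup.subset_closure hb)
    exact h2 _ h1

theorem list_prod_pow_mem {H : Type*} [Group H] {x : ι → H} {S : Set H} (h1 : 1 ∈ S)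
    (hx : ∀ i, x i ∈ S) {e : ι → ℕ} {E : ℕ} (he : ∀ i, e i ≤ E) :
    ∀ l : List ι, (l.map fun i => x i ^ e i).prod ∈ S ^ (E * l.length)
  | [] => by simp
  | i :: l => by
    rw [List.map_cons, List.prod_cons, List.length_cons, mul_add_one, add_comm, pow_add]
    exact Set.mul_mem_mul (Set.pow_subset_pow_right h1 (he i) (Set.pow_mem_pow (hx i)))
      (list_prod_pow_mem h1 hx he l)

theorem card_support_le_of_mem_pow {m : ℕ} {S : Set (Perm (Fin m))} {M : ℕ}
    (hS : ∀ s ∈ S, s.support.card ≤ M) : ∀ (n : ℕ) (y : Perm (Fin m)), y ∈ S ^ n →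
    y.support.card ≤ n * M
  | 0, y, hy => by
    rw [pow_zero, Set.mem_one] at hy
    simp [hy]
  | n + 1, y, hy => by
    rw [pow_succ] at hy
    obtain ⟨a, ha, b, hb, rfl⟩ := hy
    have h1 := card_support_le_of_mem_pow hS n a ha
    have h2 := hS b hb
    have h3 := (Finset.card_le_card (support_mul_le a b)).trans (Finset.card_union_le _ _)
    rw [add_one_mul]
    change (a * b).support.card ≤ _
    omega

/-- In a product of alternating or symmetric groups: the elements of a normal closure of `x` whose
supports are coordinatewise comparable with those of `x` are boundedly short consequences. -/
theorem exists_consequence_bound (C r : ℕ) : ∃ N : ℕ, ∀ {J : Type v} {ι : Type u} [Fintype ι]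
    {H : J → Type u} [∀ j, Group (H j)] {m : J → ℕ} (f : ∀ j, H j →* Perm (Fin (m j))),
    (∀ j, Function.Injective (f j)) → (∀ j, alternatingGroup (Fin (m j)) ≤ (f j).range) →
    ∀ (x : ι → ∀ j, H j), Fintype.card ι = r → ∀ i₀, x i₀ = 1 →
    ∀ y ∈ Subgroup.normalClosure (Set.range x),
    (∀ j, ∃ i, (f j (y j)).support.card ≤ C * (f j (x i j)).support.card) →
    y ∈ conjSet (Set.range x) ^ N := by
  let E := Nat.factorial 13
  -- The ratio is that for `v⁻¹ * y` below: `E * r` for `v`, a product of at most `E * r` factors `x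
  -- i`, and `C` for `y`.
  obtain ⟨N, hN⟩ := exists_pow_bound.{u} (E * r + C)
  refine ⟨E * r + 2 * r * N, ?_⟩
  intro J ι _ H _ m f hf hA x hr i₀ hi₀ y hy hle
  -- Modulo `D` each `x i` is central, as its commutators are pairs, and has exponent dividing `E`.
  -- Hence `y` is congruent to a product `v` of bounded powers of the `x i`, and the remainder `v⁻¹
  -- * y` can be treated coordinate by coordinate.
  let D : Subgroup (∀ j, H j) :=
    Subgroup.pi Set.univ fun j => Subgroup.closure (conjPairs fun i => x i j)
  have hD : ∀ d, d ∈ D ↔ ∀ j, d j ∈ Subgroup.closure (conjPairs fun i => x i j) := fun d => by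
    simp [D, Subgroup.mem_pi]
  have hDn : D.Normal := ⟨fun d hd g => by
    rw [hD] at hd ⊢
    exact fun j => Subgroup.Normal.conj_mem inferInstance _ (hd j) (g j)⟩
  let π := QuotientGroup.mk' D
  have hcen : ∀ i, π (x i) ∈ Subgroup.center ((∀ j, H j) ⧸ D) := by
    intro i
    rw [Subgroup.mem_center_iff]
    intro g
    obtain ⟨g, rfl⟩ := QuotientGroup.mk'_surjective D g
    rw [← map_mul, ← map_mul]
    refine QuotientGroup.eq_iff_div_mem.2 ((hD _).2 fun j => Subgroup.subset_closure ?_)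
    exact ⟨i, g j, 1, by simp [div_eq_mul_inv, mul_assoc]⟩
  have hexp : ∀ i, π (x i) ^ E = 1 := by
    intro i
    rw [← map_pow]
    exact (QuotientGroup.eq_one_iff _).2
      ((hD _).2 fun j => pow_factorial_mem_closure (f j) (hf j) (hA j) (fun i => x i j) i)
  have hle_center : Subgroup.closure (Set.range fun i => π (x i)) ≤ Subgroup.center _ := by
    rw [Subgroup.closure_le]
    rintro _ ⟨i, rfl⟩
    exact hcen i
  have hnormal : (Subgroup.closure (Set.range fun i => π (x i))).Normal :=
    ⟨fun a ha g => by
      rw [Subgroup.mem_center_iff.1 (hle_center ha) g, mul_inv_cancel_right]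
      exact ha⟩
  have hπy : π y ∈ Subgroup.closure (Set.range fun i => π (x i)) := by
    have : (Subgroup.comap π (Subgroup.closure (Set.range fun i => π (x i)))).Normal :=
      Subgroup.normal_comap π
    refine Subgroup.normalClosure_le_normal
      (N := Subgroup.comap π (Subgroup.closure (Set.range fun i => π (x i)))) ?_ hy
    rintro _ ⟨i, rfl⟩
    exact Subgroup.subset_closure ⟨i, rfl⟩
  obtain ⟨e, he, hprod⟩ := exists_exponents_of_mem_closure (fun i => π (x i))
    (Nat.factorial_pos 13) hcen hexp hπy
  let v := ((Finset.univ : Finset ι).toList.map fun i => x i ^ e i).prod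
  have hlen : (Finset.univ : Finset ι).toList.length = r := by
    rw [Finset.length_toList, Finset.card_univ, hr]
  have hv : v ∈ conjSet (Set.range x) ^ (E * r) := by
    rw [← hlen]
    exact list_prod_pow_mem (subset_conjSet (Set.range x) ⟨i₀, hi₀⟩)
      (fun i => subset_conjSet (Set.range x) ⟨i, rfl⟩) he _
  have hπv : π v = π y := by
    rw [hprod, map_list_prod, List.map_map]
    simp [Function.comp_def]
  have hd : v⁻¹ * y ∈ D := QuotientGroup.eq.1 hπv
  have hdN : v⁻¹ * y ∈ conjSet (Set.range x) ^ (2 * r * N) := by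
    rw [← hr]
    refine pi_pow_mem_conjSet_pow x N _ fun j => ?_
    obtain ⟨i₁, -, hmax⟩ := Finset.exists_max_image Finset.univ
      (fun i => (f j (x i j)).support.card) ⟨i₀, Finset.mem_univ _⟩
    refine hN (f j) (hf j) (hA j) (fun i => x i j) i₁ _ ((hD _).1 hd j) ?_
    obtain ⟨i, hi⟩ := hle j
    have h1 : (f j (y j)).support.card ≤ C * (f j (x i₁ j)).support.card :=
      hi.trans (Nat.mul_le_mul_left C (hmax i (Finset.mem_univ i)))
    have h2 : (f j (v j)).support.card ≤ E * r * (f j (x i₁ j)).support.card := by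
      refine card_support_le_of_mem_pow (S := Set.range fun i => f j (x i j)) ?_ _ _ ?_
      · rintro _ ⟨i, rfl⟩
        exact hmax i (Finset.mem_univ i)
      · have h3 := list_prod_pow_mem (x := fun i => f j (x i j))
          (S := Set.range fun i => f j (x i j)) ⟨i₀, by simp [hi₀]⟩ (fun i => ⟨i, rfl⟩) he
          (Finset.univ : Finset ι).toList
        rw [hlen] at h3
        have h4 : f j (v j) =
            ((Finset.univ : Finset ι).toList.map fun i => f j (x i j) ^ e i).prod := by
          change ((f j).comp (Pi.evalMonoidHom H j)) v = _
          rw [map_list_prod, List.map_map]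
          congr 1
          refine List.map_congr_left fun i _ => ?_
          simp
        rwa [h4]
    have h5 := (Finset.card_le_card (support_mul_le (f j (v j))⁻¹ (f j (y j)))).trans
      (Finset.card_union_le _ _)
    rw [support_inv] at h5
    change (f j ((v j)⁻¹ * y j)).support.card ≤ _
    rw [map_mul, map_inv, add_mul]
    omega
  rw [pow_add, show y = v * (v⁻¹ * y) by group]
  exact Set.mul_mem_mul hv hdN

end LargeGroups

/-- The groups between an alternating group and the symmetric group of the same degree. -/
def GroupClass.altSym : GroupClass.{u} := fun H _ =>
  ∃ m : ℕ, 0 < m ∧ ∃ f : H →* Equiv.Perm (Fin m), Function.Injective f ∧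
    alternatingGroup (Fin m) ≤ f.range

theorem GroupClass.altSym_of_alt (H : Type u) [Group H] (hH : GroupClass.alt.{u} H) :
    GroupClass.altSym.{u} H := by
  obtain ⟨m, hm, ⟨e⟩⟩ := hH
  refine ⟨m, hm, (alternatingGroup (Fin m)).subtype.comp e.toMonoidHom,
    Subtype.val_injective.comp e.injective, fun σ hσ => ⟨e.symm ⟨σ, hσ⟩, by simp⟩⟩

theorem GroupClass.altSym_of_sym (H : Type u) [Group H] (hH : GroupClass.sym.{u} H) :
    GroupClass.altSym.{u} H := by
  obtain ⟨m, hm, ⟨e⟩⟩ := hH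
  exact ⟨m, hm, e.toMonoidHom, e.injective, fun σ _ => ⟨e.symm σ, by simp⟩⟩

/-! ### Amplification, and soficity from approximability by products. -/

section Pieces

variable {G : Type u} [Group G]

/-- Amplification: a map whose defects are small compared with the proportion of points moved by
`g` yields a map with small defects for which `g` moves at least half of the points. -/
theorem exists_amplification {Ω : Type u} [Finite Ω] [Nonempty Ω] (ψ : G → Equiv.Perm Ω)
    (hψ : ψ 1 = 1) {Φ : Finset G} {g : G} {C : ℝ} (hC : 0 < C) (hg : 0 < moved (ψ g))
    (hd : ∀ x ∈ defects Φ ψ, C * moved x ≤ moved (ψ g)) :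
    ∃ (Ω' : Type u) (_ : Finite Ω') (_ : Nonempty Ω') (ψ' : G → Equiv.Perm Ω'), ψ' 1 = 1 ∧
      1 / 2 ≤ moved (ψ' g) ∧ ∀ x ∈ defects Φ ψ', moved x ≤ 2 / C := by
  set p := moved (ψ g) with hp
  have hp1 : p ≤ 1 := moved_le_one _
  -- `1 ≤ k * p` brings the fixed proportion `(1 - p) ^ k` down to `1 / 2`, while `k ≤ 2 / p` keeps
  -- the defects below `(2 / p) * (p / C)`.
  let k := ⌈1 / p⌉₊
  have hk1 : 1 / p ≤ k := Nat.le_ceil _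
  have hk2 : (k : ℝ) ≤ 2 / p := by
    have h1 := (Nat.ceil_lt_add_one (by positivity : 0 ≤ 1 / p)).le
    have h2 : 1 ≤ 1 / p := by rw [le_div_iff₀ hg]; linarith
    have h3 : 2 / p = 1 / p + 1 / p := by ring
    linarith
  let P := piPerm (fun _ : Fin k => Ω)
  refine ⟨Fin k → Ω, inferInstance, inferInstance, fun a => P fun _ => ψ a, ?_, ?_, ?_⟩
  · simp only [hψ]
    exact map_one P
  · have h1 := one_sub_moved_piPerm (fun _ : Fin k => Ω) (fun _ => ψ g)
    rw [Finset.prod_const, Finset.card_univ, Fintype.card_fin, ← hp] at h1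
    have h2 : (1 - p) ^ k ≤ 1 / 2 := by
      have h3 : 1 + (k : ℝ) * p ≤ (1 + p) ^ k := one_add_mul_le_pow (by linarith) k
      have h4 : 1 ≤ (k : ℝ) * p := by rwa [div_le_iff₀ hg] at hk1
      have h5 : (1 - p) ^ k * (1 + p) ^ k ≤ 1 := by
        rw [← mul_pow]
        exact pow_le_one₀ (by nlinarith) (by nlinarith)
      have h6 : 0 ≤ (1 - p) ^ k := pow_nonneg (by linarith) k
      nlinarith
    change 1 / 2 ≤ moved (piPerm (fun _ : Fin k => Ω) fun _ => ψ g)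
    linarith
  · rintro _ ⟨a, b, ha, hb, hab, rfl⟩
    have h1 := moved_piPerm_le_sum (fun _ : Fin k => Ω)
      (fun _ => ψ a * ψ b * (ψ (a * b))⁻¹)
    rw [Finset.sum_const, Finset.card_univ, Fintype.card_fin, nsmul_eq_mul] at h1
    have h2 := hd _ ⟨a, b, ha, hb, hab, rfl⟩
    refine le_trans h1 ?_
    have h3 := moved_nonneg (ψ a * ψ b * (ψ (a * b))⁻¹)
    rw [le_div_iff₀ hC]
    calc (k : ℝ) * moved (ψ a * ψ b * (ψ (a * b))⁻¹) * C
        = k * (C * moved (ψ a * ψ b * (ψ (a * b))⁻¹)) := by ring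
      _ ≤ 2 / p * p := mul_le_mul hk2 h2 (by positivity) (by positivity)
      _ = 2 := div_mul_cancel₀ _ hg.ne'

/-- The regular representation of a finite group. -/
theorem moved_toPermHom {Q : Type u} [Group Q] [Finite Q] {q : Q} (hq : q ≠ 1) :
    moved (MulAction.toPermHom Q Q q) = 1 := by
  have e : {x // MulAction.toPermHom Q Q q x ≠ x} ≃ Q :=
    Equiv.subtypeUnivEquiv fun x => by simpa using hq
  rw [moved, Nat.card_congr e, div_self]
  exact_mod_cast Nat.card_pos.ne'

/-- In the product action over the nontrivial `g ∈ Φ`, defects at most add up, while each `g` moves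
at least as large a proportion as in its own factor. -/
theorem isSofic_of_pieces
    (h : ∀ (Φ : Finset G) (δ : ℝ), 0 < δ → ∀ g ∈ Φ, g ≠ 1 →
      ∃ (Ω : Type u) (_ : Finite Ω) (_ : Nonempty Ω) (ψ : G → Equiv.Perm Ω), ψ 1 = 1 ∧
        1 / 2 ≤ moved (ψ g) ∧ ∀ x ∈ defects Φ ψ, moved x ≤ δ) : IsSofic G := by
  classical
  refine isSofic_of_perm fun Φ ε hε => ?_
  let T := {g : Φ // (g : G) ≠ 1}
  have hδ : 0 < ε / (Fintype.card T + 1) := by positivity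
  choose Ω _ _ ψ h1 h2 h3 using fun t : T => h Φ _ hδ t.1 t.1.2 t.2
  let P := piPerm Ω
  refine ⟨∀ t, Ω t, inferInstance, inferInstance, fun g => P fun t => ψ t g, ?_, ?_, ?_⟩
  · simp only [h1]
    exact map_one P
  · intro g hg hg1
    exact (h2 ⟨⟨g, hg⟩, hg1⟩).trans (le_moved_piPerm Ω (fun t => ψ t g) ⟨⟨g, hg⟩, hg1⟩)
  · intro g hg k hk hgk
    refine (moved_piPerm_le_sum Ω fun t => ψ t g * ψ t k * (ψ t (g * k))⁻¹).trans_lt ?_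
    refine (Finset.sum_le_card_nsmul Finset.univ _ _ fun t _ =>
      h3 t _ ⟨g, k, hg, hk, hgk, rfl⟩).trans_lt ?_
    rw [nsmul_eq_mul, Finset.card_univ, mul_div_assoc', div_lt_iff₀ (by positivity)]
    nlinarith

theorem defects_mono {H : Type*} [Group H] {Φ Ψ : Finset G} (h : Φ ⊆ Ψ) (φ : G → H) :
    defects Φ φ ⊆ defects Ψ φ := by
  rintro _ ⟨a, b, ha, hb, hab, rfl⟩
  exact ⟨a, b, h ha, h hb, h hab, rfl⟩

theorem isSofic_of_altSym_prod_approx (hG : GroupClass.altSym.{u}.prod.approx G) : IsSofic G := by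
  classical
  refine isSofic_of_pieces fun Φ δ hδ g hg hg1 => ?_
  let Ψ := insert 1 Φ
  have hΦΨ : Φ ⊆ Ψ := Finset.subset_insert 1 Φ
  have h1Ψ : (1 : G) ∈ Ψ := Finset.mem_insert_self 1 Φ
  let ι := {p : Ψ × Ψ // (p.1 * p.2 : G) ∈ Ψ}
  obtain ⟨C, hC⟩ := exists_nat_gt (2 / δ)
  have hC0 : (0 : ℝ) < C := lt_trans (by positivity) hC
  -- `N` depends only on `C` and the number of labels of defects, so it may be fixed before the
  -- approximation is chosen.
  obtain ⟨N, hN⟩ := exists_consequence_bound.{u, 0} C (Fintype.card ι)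
  rw [GroupClass.approx_iff] at hG
  obtain ⟨H, _, φ₀, ⟨n, L, _, hL, ⟨e⟩⟩, hφ₀1, hφ₀⟩ := hG Ψ N
  choose m hm f hf hA using hL
  let φ : G → ∀ j, L j := fun a => e (φ₀ a)
  have hφ1 : φ 1 = 1 := by simp [φ, hφ₀1]
  let x : ι → ∀ j, L j := fun i =>
    φ i.1.1 * φ i.1.2 * (φ (i.1.1 * i.1.2))⁻¹
  have hrange : Set.range x = defects Ψ φ := by
    ext z
    constructor
    · rintro ⟨i, rfl⟩
      exact ⟨_, _, i.1.1.2, i.1.2.2, i.2, rfl⟩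
    · rintro ⟨a, b, ha, hb, hab, rfl⟩
      exact ⟨⟨(⟨a, ha⟩, ⟨b, hb⟩), hab⟩, rfl⟩
  have hsep : φ g ∉ conjSet (Set.range x) ^ N := by
    intro hmem
    apply hφ₀ g (hΦΨ hg) hg1
    have h1 : e.symm.toMonoidHom (φ g) ∈ e.symm.toMonoidHom '' (conjSet (Set.range x) ^ N) :=
      ⟨_, hmem, rfl⟩
    rw [Set.image_pow] at h1
    have h2 := Set.pow_subset_pow_left (image_conjSet_subset e.symm.toMonoidHom (Set.range x)) h1
    have himg : e.symm.toMonoidHom '' Set.range x = defects Ψ φ₀ := by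
      rw [hrange]
      ext z
      constructor
      · rintro ⟨_, ⟨a, b, ha, hb, hab, rfl⟩, rfl⟩
        exact ⟨a, b, ha, hb, hab, by simp [φ]⟩
      · rintro ⟨a, b, ha, hb, hab, rfl⟩
        exact ⟨_, ⟨a, b, ha, hb, hab, rfl⟩, by simp [φ]⟩
    have hval : e.symm.toMonoidHom (φ g) = φ₀ g := e.symm_apply_apply (φ₀ g)
    rwa [himg, hval] at h2
  have hfin : ∀ j, Finite (L j) := fun j => Finite.of_injective _ (hf j)
  by_cases hnc : φ g ∈ Subgroup.normalClosure (Set.range x)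
  -- Otherwise every coordinate of `φ g` is comparable with some defect, and `φ g` would be an
  -- `N`-consequence.
  · obtain ⟨j, hj⟩ : ∃ j, ∀ i,
        C * (f j (x i j)).support.card < (f j (φ g j)).support.card := by
      by_contra! hcon
      exact hsep (hN f hf hA x rfl ⟨(⟨1, h1Ψ⟩, ⟨1, h1Ψ⟩), by simpa using h1Ψ⟩
        (by simp [x, hφ1]) _ hnc hcon)
    have : Nonempty (Fin (m j)) := ⟨⟨0, hm j⟩⟩
    let ψ : G → Equiv.Perm (ULift.{u} (Fin (m j))) := fun a =>
      Equiv.ulift.symm.permCongrHom (f j (φ a j))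
    have hψd : ∀ y ∈ defects Ψ ψ, ∃ i, moved y = moved (f j (x i j)) := by
      rintro _ ⟨a, b, ha, hb, hab, rfl⟩
      refine ⟨⟨(⟨a, ha⟩, ⟨b, hb⟩), hab⟩, ?_⟩
      simp only [ψ, ← map_mul, ← map_inv]
      exact moved_permCongr _ _
    have hψg : moved (ψ g) = moved (f j (φ g j)) := moved_permCongr _ _
    have hm0 : (0 : ℝ) < m j := by exact_mod_cast hm j
    have hlt : ∀ i, C * moved (f j (x i j)) < moved (f j (φ g j)) := by
      intro i
      rw [moved_eq, moved_eq, Fintype.card_fin, mul_div_assoc']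
      refine div_lt_div_of_pos_right ?_ hm0
      exact_mod_cast hj i
    have hpos : 0 < moved (ψ g) := by
      rw [hψg]
      refine lt_of_le_of_lt ?_ (hlt ⟨(⟨1, h1Ψ⟩, ⟨1, h1Ψ⟩), by simpa using h1Ψ⟩)
      exact mul_nonneg hC0.le (moved_nonneg _)
    obtain ⟨Ω', i1, i2, ψ', h1, h2, h3⟩ := exists_amplification ψ (Φ := Ψ) (g := g)
      (by simp only [ψ]; rw [hφ1, Pi.one_apply, map_one, map_one]) hC0 hpos (fun y hy => by
        obtain ⟨i, hi⟩ := hψd y hy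
        rw [hi, hψg]
        exact (hlt i).le)
    refine ⟨Ω', i1, i2, ψ', h1, h2, fun y hy => (h3 y (defects_mono hΦΨ _ hy)).trans ?_⟩
    rw [div_lt_iff₀ hδ] at hC
    rw [div_le_iff₀ hC0]
    linarith
  -- The quotient by the normal closure kills all defects but not `φ g`, so its regular
  -- representation is the required piece.
  · let K := Subgroup.normalClosure (Set.range x)
    let ρ := (MulAction.toPermHom ((∀ j, L j) ⧸ K) ((∀ j, L j) ⧸ K)).comp (QuotientGroup.mk' K)
    refine ⟨(∀ j, L j) ⧸ K, inferInstance, inferInstance, fun a => ρ (φ a), by simp [hφ1], ?_, ?_⟩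
    · have : (QuotientGroup.mk' K) (φ g) ≠ 1 := fun h => hnc ((QuotientGroup.eq_one_iff _).1 h)
      change 1 / 2 ≤ moved (MulAction.toPermHom _ _ (QuotientGroup.mk' K (φ g)))
      rw [moved_toPermHom this]
      norm_num
    · rintro _ ⟨a, b, ha, hb, hab, rfl⟩
      have hmem : φ a * φ b * (φ (a * b))⁻¹ ∈ K := by
        apply Subgroup.subset_normalClosure
        rw [hrange]
        exact ⟨a, b, hΦΨ ha, hΦΨ hb, hΦΨ hab, rfl⟩
      have h1 : ρ (φ a * φ b * (φ (a * b))⁻¹) = 1 := by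
        have h0 : QuotientGroup.mk' K (φ a * φ b * (φ (a * b))⁻¹) = 1 :=
          (QuotientGroup.eq_one_iff _).2 hmem
        rw [MonoidHom.comp_apply, h0, map_one]
      rw [← map_inv, ← map_mul, ← map_mul, h1, moved_one]
      exact hδ.le

end Pieces

/-! ### Closing the circle through soficity. -/

theorem GroupClass.approx_imp_isSofic {K : GroupClass.{u}}
    (hK : ∀ (H : Type u) [Group H], K H → GroupClass.altSym.{u} H) (G : Type u) [Group G]
    (hG : K.prod.approx G) : IsSofic G :=
  isSofic_of_altSym_prod_approx (GroupClass.approx_mono (GroupClass.prod_mono hK) G hG)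

theorem GroupClass.alt_approx : GroupClass.alt.{u}.approx = GroupClass.alt.{u}.prod.approx :=
  GroupClass.approx_eq_prod_approx_of_imp fun G _ hG =>
    (GroupClass.approx_imp_isSofic GroupClass.altSym_of_alt G hG).alt_approx

theorem GroupClass.sym_approx : GroupClass.sym.{u}.approx = GroupClass.sym.{u}.prod.approx :=
  GroupClass.approx_eq_prod_approx_of_imp fun G _ hG =>
    (GroupClass.approx_imp_isSofic GroupClass.altSym_of_sym G hG).sym_approx

theorem isSofic_iff_alt_approx (G : Type u) [Group G] : IsSofic G ↔ GroupClass.alt.{u}.approx G :=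
  ⟨IsSofic.alt_approx, fun h => GroupClass.approx_imp_isSofic GroupClass.altSym_of_alt G
    (GroupClass.alt_approx ▸ h)⟩

theorem mainTheorem3 :
    (∀ K : GroupClass.{u}, (∀ (H : Type u) [Group H], K H → Finite H) →
      K.approx = K.prod.approx →
      ∀ (G : Type u) [Group G], K.approx G ↔ ∀ w ∈ K.sys, w.SolvableOver G) ∧
    (∀ K ∈ ({GroupClass.nil, GroupClass.sol, GroupClass.fin, GroupClass.alt, GroupClass.sym} :
        Set GroupClass.{u}),
      K.approx = K.prod.approx ∧
      ∀ (G : Type u) [Group G], K.approx G ↔ ∀ w ∈ K.sys, w.SolvableOver G) ∧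
    (∀ (G : Type u) [Group G],
      IsSofic G ↔ ∀ w ∈ GroupClass.alt.{u}.sys, w.SolvableOver G) := by
  refine ⟨fun K _ hK => GroupClass.approx_iff_solvableOver hK, fun K hK => ?_, fun G _ => ?_⟩
  · have h : K.approx = K.prod.approx := by
      rcases hK with rfl | rfl | rfl | rfl | rfl
      exacts [GroupClass.nil_approx, GroupClass.sol_approx, GroupClass.fin_approx,
        GroupClass.alt_approx, GroupClass.sym_approx]
    exact ⟨h, GroupClass.approx_iff_solvableOver h⟩
  · rw [isSofic_iff_alt_approx]
    exact GroupClass.approx_iff_solvableOver GroupClass.alt_approx G
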